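/- Let $\Gamma$ be a finite acyclic perfect cylindrical network with $N$ sources and $N$ sinks, that is, a finite directed graph without directed cycles, embedded in an oriented cylinder, with univalent boundary vertices, all $N$ sources on one boundary circle and all $N$ sinks on the other one, and with trivalent internal vertices, each having at least one incoming and at least one outgoing edge. (An internal vertex is white if it has exactly one incoming edge and black if it has exactly one outgoing edge.) Fix a cut: an oriented curve from the source circle to the sink circle, avoiding the vertices and transversal to the edges. Draw the cylinder cut open along the cut as a rectangle, with sources on the left edge, sinks on the right edge, the cut being the top and bottom edges oriented from left to right; number the sources and the sinks $1,\dots,N$ from top to bottom. Let $\mathbf k=\mathbb C(\lambda,\mu)$. Glue the boundary circles, identifying the $i$-th sink with the $i$-th source, to get a network on a torus with $N$ marked points, and let $\mathcal C$ be the $\mathbf k$-linear category whose objects are the marked points and whose morphisms are the $\mathbf k$-linear combinations of directed paths between marked points in the torus network, $fg$ being "first $f$, then $g$". The boundary measurement matrix $B(\lambda)\in\mathrm{Mat}_N(\mathcal C)$ has the entries $B(\lambda)_{ij}=\sum_{p:i\to j}\lambda^{d(p)}\,p$, the sum being over the directed paths $p$ in $\Gamma$ from source $i$ to sink $j$, and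 $d(p)\in\mathbb Z$ being the oriented intersection index of $p$ with the cut (a crossing from the right side of the cut to its left side counts $+1$, the opposite one $-1$). Let $\{\!\{-,-\}\!\}:\mathrm{Hom}(a,b)\otimes\mathrm{Hom}(c,d)\to\mathrm{Hom}(c,b)\otimes\mathrm{Hom}(a,d)$ be the double bracket on paths of the torus network determined by skew-symmetry $\{\!\{f,g\}\!\}=-\{\!\{g,f\}\!\}^\tau$, the Leibniz identities $\{\!\{fg,h\}\!\}=(1\otimes f)\{\!\{g,h\}\!\}+\{\!\{f,h\}\!\}(g\otimes1)$, $\{\!\{f,gh\}\!\}=(g\otimes1)\{\!\{f,h\}\!\}+\{\!\{f,g\}\!\}(1\otimes h)$, and its values on edges, which are sums of the following contributions of internal vertices: $\{\!\{x_1,x_2\}\!\}=\tfrac12\,x_1\otimes x_2$ at a white vertex whose edges in counterclockwise order are $x_1,x_2,x_3$ with $x_3$ incoming; $\{\!\{y_1,y_2\}\!\}=-\tfrac12\,y_2\otimes y_1$ at a black vertex whose edges in counterclockwise order are $y_1,y_2,y_3$ with $y_3$ outgoing; all other contributions vanish. It restricts to $\mathcal C$. Let $\mathcal C_\natural=\bigl(\bigoplus_X\mathrm{Hom}_{\mathcal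 C}(X,X)\bigr)/[\mathcal C,\mathcal C]$, write $\overline f$ for the class of $f$, and let $\{-,-\}:\mathcal C_\natural\otimes\mathcal C\to\mathcal C$ be the induced $H_0$-Poisson bracket: $\{\overline f,g\}$ is obtained from $\{\!\{f,g\}\!\}$ by concatenating the two tensor factors. Let $\rho_{ab}(\lambda,\mu)$ be the coefficients of the trigonometric $r$-matrix $$r(\lambda,\mu)=\frac12\,\frac{\mu+\lambda}{\mu-\lambda}\sum_{a}E_{aa}\boxtimes E_{aa}+\frac1{\mu-\lambda}\sum_{a<b}\bigl(\lambda\,E_{ab}\boxtimes E_{ba}+\mu\,E_{ba}\boxtimes E_{ab}\bigr)=\sum_{a,b=1}^N\rho_{ab}(\lambda,\mu)\,E_{ab}\boxtimes E_{ba}.$$ Then for every integer $k\ge 0$ the matrix $B$ satisfies, entry by entry, the Lax equation $$\bigl\{\overline{\operatorname{tr}B(\lambda)^k},\,B(\mu)\bigr\}=M(\lambda,\mu;k)\,B(\mu)-B(\mu)\,M(\lambda,\mu;k),\qquad M(\lambda,\mu;k)_{b_1b_2}=k\,\rho_{b_2b_1}(\lambda,\mu)\,\bigl(B(\lambda)^k\bigr)_{b_1b_2}.$$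 -/

import Mathlib

open scoped TensorProduct DirectSum

noncomputable section

namespace NCNetwork

universe u v w

/-! ## Linear path categories, matrices, cyclic spaces -/

section PathCategory

variable (K : Type w) [Field K] {Q : Type u} [Quiver.{v} Q]

/-- Morphisms `a ⟶ b` of the `K`-linear category generated by the quiver `Q`:
finite `K`-linear combinations of paths from `a` to `b`. -/
def Mor (a b : Q) : Type (max u v w) := Quiver.Path a b →₀ K

instance (a b : Q) : AddCommGroup (Mor K a b) := inferInstanceAs (AddCommGroup (_ →₀ K))

instance (a b : Q) : Module K (Mor K a b) := inferInstanceAs (Module K (_ →₀ K))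

/-- The basis morphism given by a path. -/
def ofPath {a b : Q} (p : Quiver.Path a b) : Mor K a b := Finsupp.single p 1

/-- Linear extension of a map defined on paths. -/
def Mor.lift {a b : Q} {X : Type*} [AddCommGroup X] [Module K X] (φ : Quiver.Path a b → X) :
    Mor K a b →ₗ[K] X :=
  Finsupp.linearCombination K φ

/-- Concatenation `Hom(a,b) × Hom(b,c) → Hom(a,c)`, written `f g` (first `f`, then `g`). -/
def concat (a b c : Q) : Mor K a b →ₗ[K] Mor K b c →ₗ[K] Mor K a c :=
  Mor.lift K fun p => Mor.lift K fun q => ofPath K (p.comp q)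

variable {K}

@[simp]
theorem Mor.lift_ofPath {a b : Q} {X : Type*} [AddCommGroup X] [Module K X]
    (φ : Quiver.Path a b → X) (p : Quiver.Path a b) : Mor.lift K φ (ofPath K p) = φ p :=
  (Finsupp.linearCombination_single K 1 p).trans (one_smul K _)

theorem Mor.hom_ext {a b : Q} {X : Type*} [AddCommGroup X] [Module K X]
    {φ ψ : Mor K a b →ₗ[K] X} (h : ∀ p, φ (ofPath K p) = ψ (ofPath K p)) : φ = ψ :=
  Finsupp.lhom_ext' fun p => LinearMap.ext_ring (h p)

theorem Mor.induction {a b : Q} {P : Mor K a b → Prop} (f : Mor K a b) (zero : P 0)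
    (add : ∀ f g, P f → P g → P (f + g)) (smul : ∀ (r : K) f, P f → P (r • f))
    (basis : ∀ p, P (ofPath K p)) : P f := by
  refine Finsupp.induction_linear (motive := P) f zero add fun p r => ?_
  have h := smul r _ (basis p)
  have e : r • ofPath K p = (Finsupp.single p r : Quiver.Path a b →₀ K) :=
    Finsupp.smul_single_one p r
  exact e ▸ h

@[simp]
theorem concat_ofPath {a b c : Q} (p : Quiver.Path a b) (q : Quiver.Path b c) :
    concat K a b c (ofPath K p) (ofPath K q) = ofPath K (p.comp q) := by
  simp [concat]

theorem concat_assoc {a b c d : Q} (f : Mor K a b) (g : Mor K b c) (h : Mor K c d) :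
    concat K a c d (concat K a b c f g) h = concat K a b d f (concat K b c d g h) := by
  induction f using Mor.induction with
  | zero => simp
  | add f₁ f₂ h₁ h₂ => simp [h₁, h₂]
  | smul r f hf => simp [hf]
  | basis p =>
    induction g using Mor.induction with
    | zero => simp
    | add f₁ f₂ h₁ h₂ => simp [h₁, h₂]
    | smul r f hf => simp [hf]
    | basis q =>
      induction h using Mor.induction with
      | zero => simp
      | add f₁ f₂ h₁ h₂ => simp only [map_add, h₁, h₂]
      | smul r f hf => simp only [map_smul, hf]
      | basis q' => simp

variable (K)

/-- `f ↦ (x ↦ f x)`. -/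
abbrev lmul {a b : Q} (c : Q) (f : Mor K a b) : Mor K b c →ₗ[K] Mor K a c := concat K a b c f

/-- `f ↦ (x ↦ x f)`. -/
abbrev rmul (a : Q) {b c : Q} (f : Mor K b c) : Mor K a b →ₗ[K] Mor K a c :=
  (concat K a b c).flip f

/-- Square matrices with `(i,j)` entry in `Hom(x i, x j)`: matrices over the full subcategory
on the objects `x i`. -/
abbrev PMat {ι : Type} (x : ι → Q) : Type (max u v w) := ∀ i j, Mor K (x i) (x j)

variable {K}

/-- Matrix product: `(A B)_{il} = ∑_j A_{ij} B_{jl}`. -/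
def PMat.mul {ι : Type} [Fintype ι] {x : ι → Q} (A B : PMat K x) : PMat K x :=
  fun i l => ∑ j, concat K (x i) (x j) (x l) (A i j) (B j l)

variable (K) in
/-- The identity matrix. -/
def PMat.one {ι : Type} [DecidableEq ι] (x : ι → Q) : PMat K x := fun i j =>
  if h : i = j then ofPath K (Quiver.Path.nil.cast rfl (congrArg x h)) else 0

/-- Powers of a square matrix. -/
def PMat.pow {ι : Type} [Fintype ι] [DecidableEq ι] {x : ι → Q} (A : PMat K x) : ℕ → PMat K x
  | 0 => PMat.one K x
  | k + 1 => PMat.mul (PMat.pow A k) A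

/-- Span of the commutators `f g - g f`, for `f : x i ⟶ x j` and `g : x j ⟶ x i`. -/
def commutators (K : Type w) [Field K] {ι : Type} [DecidableEq ι] (x : ι → Q) :
    Submodule K (⨁ i, Mor K (x i) (x i)) :=
  Submodule.span K {z | ∃ (i j : ι) (f : Mor K (x i) (x j)) (g : Mor K (x j) (x i)),
    z = DirectSum.lof K ι (fun i => Mor K (x i) (x i)) i (concat K _ _ _ f g) -
      DirectSum.lof K ι (fun i => Mor K (x i) (x i)) j (concat K _ _ _ g f)}

/-- The cyclic space `C_♮ = (⨁_X Hom(X,X)) / [C,C]` of the full subcategory `C` on the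
objects `x i`. -/
abbrev CyclicSpace (K : Type w) [Field K] {ι : Type} [DecidableEq ι] (x : ι → Q) :=
  (⨁ i, Mor K (x i) (x i)) ⧸ commutators K x

/-- The class in the cyclic space of the trace of a square matrix. -/
def PMat.cyclicTrace {ι : Type} [Fintype ι] [DecidableEq ι] {x : ι → Q} (A : PMat K x) :
    CyclicSpace K x :=
  (commutators K x).mkQ (∑ i, DirectSum.lof K ι (fun i => Mor K (x i) (x i)) i (A i i))

end PathCategory

/-! ## Double brackets and the induced `H₀`-Poisson bracket -/

section DoubleBrackets

variable (K : Type w) [Field K] (Q : Type u) [Quiver.{v} Q]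

/-- A double bracket on the `K`-linear path category of `Q`: a family of maps
`Hom(a,b) ⊗ Hom(c,d) → Hom(c,b) ⊗ Hom(a,d)`, skew-symmetric and satisfying the double
Leibniz identities
`{{fg,h}} = (1 ⊗ f){{g,h}} + {{f,h}}(g ⊗ 1)` and `{{f,gh}} = (g ⊗ 1){{f,h}} + {{f,g}}(1 ⊗ h)`. -/
structure DoubleBracket where
  br : ∀ a b c d : Q, Mor K a b →ₗ[K] Mor K c d →ₗ[K] Mor K c b ⊗[K] Mor K a d
  skew : ∀ {a b c d : Q} (f : Mor K a b) (g : Mor K c d),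
    br a b c d f g = -TensorProduct.comm K (Mor K a d) (Mor K c b) (br c d a b g f)
  leibniz_left : ∀ {a b c p q : Q} (f : Mor K a b) (g : Mor K b c) (h : Mor K p q),
    br a c p q (concat K a b c f g) h =
      TensorProduct.map LinearMap.id (lmul K q f) (br b c p q g h) +
      TensorProduct.map (rmul K p g) LinearMap.id (br a b p q f h)
  leibniz_right : ∀ {p q a b c : Q} (f : Mor K p q) (g : Mor K a b) (h : Mor K b c),
    br p q a c f (concat K a b c g h) =
      TensorProduct.map (lmul K q g) LinearMap.id (br p q b c f h) +
      TensorProduct.map LinearMap.id (rmul K p h) (br p q a b f g)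

variable {K Q}

/-- `{f, g} = μ({{f, g}})` for a loop `f` and a morphism `g`. -/
def DoubleBracket.loopBracket (D : DoubleBracket K Q) (a c d : Q) :
    Mor K a a →ₗ[K] Mor K c d →ₗ[K] Mor K c d :=
  (D.br a a c d).compr₂ (TensorProduct.lift (concat K c a d))

theorem DoubleBracket.loopBracket_comm (D : DoubleBracket K Q) {a b : Q} (c d : Q)
    (f : Mor K a b) (g : Mor K b a) (h : Mor K c d) :
    D.loopBracket a c d (concat K a b a f g) h = D.loopBracket b c d (concat K b a b g f) h := by
  have key : ∀ {a b : Q} (f : Mor K a b) (t : Mor K c a ⊗[K] Mor K b d),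
      TensorProduct.lift (concat K c a d) (TensorProduct.map LinearMap.id (lmul K d f) t) =
        TensorProduct.lift (concat K c b d) (TensorProduct.map (rmul K c f) LinearMap.id t) := by
    intro a b f t
    induction t using TensorProduct.induction_on with
    | zero => simp
    | tmul u v => simp [concat_assoc]
    | add s t hs ht => simp only [map_add, hs, ht]
  simp only [loopBracket, LinearMap.compr₂_apply, D.leibniz_left, map_add]
  rw [key, key, add_comm]

/-- The `H₀`-Poisson bracket `{-,-} : C_♮ ⊗ C → C` induced by a double bracket, where `C` is the
full subcategory on the objects `x i`: it sends the class of a loop `f` and a morphism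
`g : x c ⟶ x d` to the concatenation of the two tensor factors of `{{f, g}}`. -/
def DoubleBracket.hBracket (D : DoubleBracket K Q) {ι : Type} [DecidableEq ι] (x : ι → Q)
    (c d : ι) : CyclicSpace K x →ₗ[K] Mor K (x c) (x d) →ₗ[K] Mor K (x c) (x d) :=
  (commutators K x).liftQ
    (DirectSum.toModule K ι _ fun i => D.loopBracket (x i) (x c) (x d)) (by
      rw [commutators, Submodule.span_le]
      rintro z ⟨i, j, f, g, rfl⟩
      simp only [SetLike.mem_coe, LinearMap.mem_ker, map_sub, DirectSum.toModule_lof]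
      rw [sub_eq_zero]
      exact LinearMap.ext fun t => D.loopBracket_comm (x c) (x d) f g t)

/-! ### The double bracket with prescribed values on arrows -/

/-- Values of a prospective double bracket on pairs of arrows. -/
abbrev ArrowBracket (K : Type w) [Field K] (Q : Type u) [Quiver.{v} Q] :=
  ∀ ⦃a b c d : Q⦄, (a ⟶ b) → (c ⟶ d) → Mor K c b ⊗[K] Mor K a d

/-- Extension to (arrow, path) by the second Leibniz identity. -/
def arrowPathBr (eb : ArrowBracket K Q) {a b : Q} (e : a ⟶ b) {c : Q} :
    ∀ {d : Q}, Quiver.Path c d → Mor K c b ⊗[K] Mor K a d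
  | _, Quiver.Path.nil => 0
  | _, Quiver.Path.cons g h =>
      TensorProduct.map (lmul K b (ofPath K g)) LinearMap.id (eb e h) +
      TensorProduct.map LinearMap.id (rmul K a (ofPath K h.toPath)) (arrowPathBr eb e g)

/-- Extension to pairs of paths by the first Leibniz identity. -/
def pathBr (eb : ArrowBracket K Q) {a c d : Q} :
    ∀ {b : Q}, Quiver.Path a b → Quiver.Path c d → Mor K c b ⊗[K] Mor K a d
  | _, Quiver.Path.nil, _ => 0
  | _, Quiver.Path.cons f e, g =>
      TensorProduct.map LinearMap.id (lmul K d (ofPath K f)) (arrowPathBr eb e g) +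
      TensorProduct.map (rmul K c (ofPath K e.toPath)) LinearMap.id (pathBr eb f g)

/-- Bilinear extension of `pathBr`. -/
def linBr (eb : ArrowBracket K Q) (a b c d : Q) :
    Mor K a b →ₗ[K] Mor K c d →ₗ[K] Mor K c b ⊗[K] Mor K a d :=
  Mor.lift K fun p => Mor.lift K fun q => pathBr eb p q

theorem lmul_nil {a b : Q} : lmul K b (ofPath K (Quiver.Path.nil : Quiver.Path a a)) =
    LinearMap.id := by
  refine Mor.hom_ext fun p => ?_; simp

theorem rmul_nil {a b : Q} : rmul K b (ofPath K (Quiver.Path.nil : Quiver.Path a a)) =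
    LinearMap.id := by
  refine Mor.hom_ext fun p => ?_; simp

theorem lmul_comp {a b c d : Q} (p : Quiver.Path a b) (q : Quiver.Path b c) :
    lmul K d (ofPath K (p.comp q)) = lmul K d (ofPath K p) ∘ₗ lmul K d (ofPath K q) := by
  refine Mor.hom_ext fun r => ?_; simp

theorem rmul_comp {a b c d : Q} (p : Quiver.Path a b) (q : Quiver.Path b c) :
    rmul K d (ofPath K (p.comp q)) = rmul K d (ofPath K q) ∘ₗ rmul K d (ofPath K p) := by
  refine Mor.hom_ext fun r => ?_; simp

theorem lmul_rmul {a b c d : Q} (p : Quiver.Path a b) (q : Quiver.Path c d) :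
    lmul K d (ofPath K p) ∘ₗ rmul K b (ofPath K q) =
      rmul K a (ofPath K q) ∘ₗ lmul K c (ofPath K p) := by
  refine Mor.hom_ext fun r => ?_; simp

theorem arrowPathBr_comp (eb : ArrowBracket K Q) {a b : Q} (e : a ⟶ b) {c p d : Q}
    (g : Quiver.Path c p) (h : Quiver.Path p d) :
    arrowPathBr eb e (g.comp h) =
      TensorProduct.map (lmul K b (ofPath K g)) LinearMap.id (arrowPathBr eb e h) +
      TensorProduct.map LinearMap.id (rmul K a (ofPath K h)) (arrowPathBr eb e g) := by
  induction h with
  | nil => simp [arrowPathBr, rmul_nil]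
  | cons h k ih =>
    rw [Quiver.Path.comp_cons, arrowPathBr, arrowPathBr, ih, lmul_comp,
      show h.cons k = h.comp k.toPath from rfl, rmul_comp]
    simp only [map_add, ← LinearMap.comp_apply, ← TensorProduct.map_comp, LinearMap.id_comp,
      LinearMap.comp_id]
    abel

theorem pathBr_comp_left (eb : ArrowBracket K Q) {a b c p d : Q} (f : Quiver.Path a b)
    (g : Quiver.Path b c) (h : Quiver.Path p d) :
    pathBr eb (f.comp g) h =
      TensorProduct.map LinearMap.id (lmul K d (ofPath K f)) (pathBr eb g h) +
      TensorProduct.map (rmul K p (ofPath K g)) LinearMap.id (pathBr eb f h) := by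
  induction g with
  | nil => simp [pathBr, rmul_nil]
  | cons g k ih =>
    rw [Quiver.Path.comp_cons, pathBr, pathBr, ih, lmul_comp,
      show g.cons k = g.comp k.toPath from rfl, rmul_comp]
    simp only [map_add, ← LinearMap.comp_apply, ← TensorProduct.map_comp, LinearMap.id_comp,
      LinearMap.comp_id]
    abel

theorem pathBr_comp_right (eb : ArrowBracket K Q) {p q a b c : Q} (f : Quiver.Path p q)
    (g : Quiver.Path a b) (h : Quiver.Path b c) :
    pathBr eb f (g.comp h) =
      TensorProduct.map (lmul K q (ofPath K g)) LinearMap.id (pathBr eb f h) +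
      TensorProduct.map LinearMap.id (rmul K p (ofPath K h)) (pathBr eb f g) := by
  induction f with
  | nil => simp [pathBr]
  | cons f k ih =>
    rw [pathBr, pathBr, pathBr, ih, arrowPathBr_comp]
    simp only [map_add, ← LinearMap.comp_apply, ← TensorProduct.map_comp, LinearMap.id_comp,
      LinearMap.comp_id, lmul_rmul]
    abel

theorem pathBr_toPath (eb : ArrowBracket K Q) {a b c d : Q} (e : a ⟶ b) (g : Quiver.Path c d) :
    pathBr eb e.toPath g = arrowPathBr eb e g := by
  rw [Quiver.Hom.toPath, pathBr, pathBr, lmul_nil]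
  simp

theorem map_comm' {A B C D : Q} {A' B' C' D' : Q} (f : Mor K A B →ₗ[K] Mor K A' B')
    (g : Mor K C D →ₗ[K] Mor K C' D') (t : Mor K C D ⊗[K] Mor K A B) :
    TensorProduct.comm K _ _ (TensorProduct.map g f t) =
      TensorProduct.map f g (TensorProduct.comm K _ _ t) := by
  induction t using TensorProduct.induction_on with
  | zero => simp
  | tmul u v => simp
  | add s t hs ht => simp only [map_add, hs, ht]

theorem arrowPathBr_skew (eb : ArrowBracket K Q)
    (hs : ∀ ⦃a b c d : Q⦄ (e : a ⟶ b) (h : c ⟶ d),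
      eb e h = -TensorProduct.comm K (Mor K a d) (Mor K c b) (eb h e))
    {a b c d : Q} (e : a ⟶ b) (g : Quiver.Path c d) :
    arrowPathBr eb e g =
      -TensorProduct.comm K (Mor K a d) (Mor K c b) (pathBr eb g e.toPath) := by
  induction g with
  | nil => simp [arrowPathBr, pathBr]
  | cons g h ih =>
    rw [arrowPathBr, pathBr, map_add, map_comm', map_comm', ih, hs]
    have : arrowPathBr eb h e.toPath = eb h e := by
      rw [Quiver.Hom.toPath, arrowPathBr, arrowPathBr, lmul_nil]
      simp
    rw [this]
    simp only [map_neg]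
    abel

theorem pathBr_skew (eb : ArrowBracket K Q)
    (hs : ∀ ⦃a b c d : Q⦄ (e : a ⟶ b) (h : c ⟶ d),
      eb e h = -TensorProduct.comm K (Mor K a d) (Mor K c b) (eb h e))
    {a b c d : Q} (f : Quiver.Path a b) (g : Quiver.Path c d) :
    pathBr eb f g = -TensorProduct.comm K (Mor K a d) (Mor K c b) (pathBr eb g f) := by
  induction f with
  | nil =>
    have : pathBr eb g (Quiver.Path.nil : Quiver.Path a a) = 0 := by
      induction g with
      | nil => rfl
      | cons g h ih => rw [pathBr, ih, arrowPathBr]; simp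
    rw [this]; simp [pathBr]
  | cons f e ih =>
    rw [pathBr, show f.cons e = f.comp e.toPath from rfl, pathBr_comp_right, map_add, map_comm',
      map_comm', ih, arrowPathBr_skew eb hs]
    simp only [map_neg]
    abel

/-- The double bracket on the path category with prescribed (skew-symmetric) values on arrows. -/
def DoubleBracket.ofArrows (eb : ArrowBracket K Q)
    (hs : ∀ ⦃a b c d : Q⦄ (e : a ⟶ b) (h : c ⟶ d),
      eb e h = -TensorProduct.comm K (Mor K a d) (Mor K c b) (eb h e)) :
    DoubleBracket K Q where
  br := linBr eb
  skew {a b c d} f g := by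
    induction f using Mor.induction with
    | zero => simp
    | add f₁ f₂ h₁ h₂ => simp only [map_add, LinearMap.add_apply, h₁, h₂, neg_add]
    | smul r f hf => simp only [map_smul, LinearMap.smul_apply, hf, smul_neg]
    | basis p =>
      induction g using Mor.induction with
      | zero => simp
      | add f₁ f₂ h₁ h₂ => simp only [map_add, LinearMap.add_apply, h₁, h₂, neg_add]
      | smul r f hf => simp only [map_smul, LinearMap.smul_apply, hf, smul_neg]
      | basis q =>
        simp only [linBr, Mor.lift_ofPath]
        exact pathBr_skew eb hs p q
  leibniz_left {a b c p q} f g h := by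
    induction f using Mor.induction with
    | zero => simp
    | add f₁ f₂ h₁ h₂ =>
      simp only [map_add, LinearMap.add_apply, h₁, h₂, TensorProduct.map_add_right]; abel
    | smul r f hf =>
      simp only [map_smul, LinearMap.smul_apply, hf, TensorProduct.map_smul_right, smul_add]
    | basis x =>
      induction g using Mor.induction with
      | zero => simp
      | add f₁ f₂ h₁ h₂ =>
        simp only [map_add, LinearMap.add_apply, h₁, h₂, TensorProduct.map_add_left]; abel
      | smul r f hf =>
        simp only [map_smul, LinearMap.smul_apply, hf, TensorProduct.map_smul_left, smul_add]
      | basis y =>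
        induction h using Mor.induction with
        | zero => simp
        | add f₁ f₂ h₁ h₂ => simp only [map_add, h₁, h₂]; abel
        | smul r f hf => simp only [map_smul, hf, smul_add]
        | basis z =>
          simp only [concat_ofPath, linBr, Mor.lift_ofPath]
          exact pathBr_comp_left eb x y z
  leibniz_right {p q a b c} f g h := by
    induction f using Mor.induction with
    | zero => simp
    | add f₁ f₂ h₁ h₂ => simp only [map_add, LinearMap.add_apply, h₁, h₂]; abel
    | smul r f hf => simp only [map_smul, LinearMap.smul_apply, hf, smul_add]
    | basis x =>
      induction g using Mor.induction with
      | zero => simp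
      | add f₁ f₂ h₁ h₂ =>
        simp only [map_add, LinearMap.add_apply, h₁, h₂, TensorProduct.map_add_left]; abel
      | smul r f hf =>
        simp only [map_smul, LinearMap.smul_apply, hf, TensorProduct.map_smul_left, smul_add]
      | basis y =>
        induction h using Mor.induction with
        | zero => simp
        | add f₁ f₂ h₁ h₂ =>
          simp only [map_add, h₁, h₂, TensorProduct.map_add_right, LinearMap.add_apply]; abel
        | smul r f hf => simp only [map_smul, hf, TensorProduct.map_smul_right,
            LinearMap.smul_apply, smul_add]
        | basis z =>
          simp only [concat_ofPath, linBr, Mor.lift_ofPath]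
          exact pathBr_comp_right eb x y z

end DoubleBrackets

/-! ## Networks on the cylinder -/

/-- Vertices of a network with `m` sources on one boundary circle of the cylinder, `n` sinks on
the other one, and internal vertices `V`. -/
inductive CylVertex (V : Type u) (m n : ℕ) : Type u
  | source (i : Fin m) : CylVertex V m n
  | inner (v : V) : CylVertex V m n
  | sink (j : Fin n) : CylVertex V m n

/-- A directed multigraph with a rotation system. A dart (half-edge) is a pair `(e, s)`, where
`(e, false)` is the half of `e` at its tail and `(e, true)` the half at its head; `rot` sends a
dart to the next dart in the counterclockwise order at the same vertex, where each of the two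
boundary circles of the cylinder is regarded as one vertex. -/
structure RibbonNetwork (V : Type u) (E : Type v) (m n : ℕ) where
  src : E → CylVertex V m n
  tgt : E → CylVertex V m n
  rot : Equiv.Perm (E × Bool)

namespace RibbonNetwork

variable {V : Type u} {E : Type v} {m n : ℕ} (G : RibbonNetwork V E m n)

/-- The vertex of a dart. -/
def dartVertex : E × Bool → CylVertex V m n
  | (e, false) => G.src e
  | (e, true) => G.tgt e

/-- The other half of the same edge. -/
def flip (d : E × Bool) : E × Bool := (d.1, !d.2)

/-- The face permutation `d ↦ rot⁻¹ (flip d)`. Its cycles are the faces; the cycle of `d` is the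
face to the left of the edge when one leaves the vertex of `d` along `d`. -/
def facePerm : Equiv.Perm (E × Bool) where
  toFun d := G.rot.symm (flip d)
  invFun d := flip (G.rot d)
  left_inv d := by simp [flip]
  right_inv d := by simp [flip]

/-- `d` and `d'` have the same face on their left. -/
def SameFace (d d' : E × Bool) : Prop := G.facePerm.SameCycle d d'

/-- The number of faces. -/
def numFaces : ℕ := Nat.card (Quotient (Equiv.Perm.SameCycle.setoid G.facePerm))

/-- A curve transversal to the graph, avoiding its vertices, and running from the face to the left
of `d` to the face to the left of `d'`, given by the list of darts that it crosses: the letter `c`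
means that the curve passes from the face to the left of `c` to the face to the right of `c`. -/
def IsTransversalCurve : E × Bool → List (E × Bool) → E × Bool → Prop
  | d, [], d' => G.SameFace d d'
  | d, c :: l, d' => G.SameFace d c ∧ IsTransversalCurve (flip c) l d'

/-- The vertices of the network, as a quiver whose arrows are the directed edges. -/
def Pt (_ : RibbonNetwork V E m n) : Type u := CylVertex V m n

/-- The `i`-th source. -/
def sourcePt (i : Fin m) : G.Pt := CylVertex.source i

/-- The `j`-th sink. -/
def sinkPt (j : Fin n) : G.Pt := CylVertex.sink j

instance : Quiver.{v} G.Pt where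
  Hom a b := {e : E // G.src e = a ∧ G.tgt e = b}

end RibbonNetwork

/-- An acyclic perfect network on the cylinder with a chosen cut, with `m` sources on one boundary
circle and `n` sinks on the other. Collapsing the two boundary circles to points turns the
cylinder into a sphere, so the embedding is given by a rotation system of genus `0`, for
which the two boundary circles count as vertices. (Since there are no directed cycles, each
internal vertex is joined to both boundary circles, so the collapsed graph is connected.)

The cut runs from the source circle to the sink circle. After cutting, the
sources lie on the left edge and the sinks on the right edge of a rectangle, both numbered from
top to bottom, and the cut forms the top and the bottom edge. -/
structure PerfectCylindricalNetwork (V : Type u) (E : Type v) [Fintype V] [Fintype E] (m n : ℕ)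
    extends RibbonNetwork V E m n where
  /-- The unique edge at the `i`-th source. -/
  sourceEdge : Fin m → E
  /-- The unique edge at the `j`-th sink. -/
  sinkEdge : Fin n → E
  src_eq_source : ∀ e i, src e = .source i ↔ e = sourceEdge i
  tgt_ne_source : ∀ e i, tgt e ≠ .source i
  tgt_eq_sink : ∀ e j, tgt e = .sink j ↔ e = sinkEdge j
  src_ne_sink : ∀ e j, src e ≠ .sink j
  /-- Internal vertices are trivalent. -/
  trivalent : ∀ v, {d | toRibbonNetwork.dartVertex d = .inner v}.ncard = 3
  /-- Internal vertices are not sources. -/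
  exists_in : ∀ v, ∃ e, tgt e = .inner v
  /-- Internal vertices are not sinks. -/
  exists_out : ∀ v, ∃ e, src e = .inner v
  /-- The rotation permutes the darts at an internal vertex cyclically. -/
  rot_inner : ∀ v d d', toRibbonNetwork.dartVertex d = .inner v →
    (rot.SameCycle d d' ↔ toRibbonNetwork.dartVertex d' = .inner v)
  /-- Counterclockwise around the source circle, the sources are met from bottom to top. -/
  rot_source : ∀ i, rot (sourceEdge (finRotate m i), false) = (sourceEdge i, false)
  /-- Counterclockwise around the sink circle, the sinks are met from top to bottom. -/
  rot_sink : ∀ j, rot (sinkEdge j, true) = (sinkEdge (finRotate n j), true)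
  /-- The collapsed surface is a sphere: (vertices) - (edges) + (faces) = 2. -/
  euler : ((Fintype.card V + 2 : ℕ) : ℤ) - Fintype.card E + toRibbonNetwork.numFaces = 2
  /-- There are no directed cycles. -/
  acyclic : ∀ (a : toRibbonNetwork.Pt) (p : Quiver.Path a a), p = Quiver.Path.nil
  /-- The darts crossed by the cut, in order. -/
  cut : List (E × Bool)
  /-- The cut starts on the source circle, between the first and the last source and just above
  (to the left of) the first one, and ends on the sink circle, just above the first sink. -/
  isCut : ∀ (i : Fin m) (j : Fin n), i.val = 0 → j.val = 0 →
    toRibbonNetwork.IsTransversalCurve (sourceEdge i, false) cut (sinkEdge j, false)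

namespace PerfectCylindricalNetwork

variable {V : Type u} {E : Type v} [Fintype V] [Fintype E] {m n : ℕ}

/-! ### Paths and boundary measurements -/

section Paths

variable (G : PerfectCylindricalNetwork V E m n)

/-- The list of edges of a path, last edge first. -/
def edgeList {a : G.Pt} : ∀ {b : G.Pt}, Quiver.Path a b → List E
  | _, Quiver.Path.nil => []
  | _, Quiver.Path.cons p e => e.1 :: edgeList p

theorem edgeList_injective {a b : G.Pt} :
    Function.Injective (G.edgeList : Quiver.Path a b → List E) := by
  intro p q h
  induction p with
  | nil =>
    cases q with
    | nil => rfl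
    | cons q e => simp [edgeList] at h
  | cons p e ih =>
    cases q with
    | nil => simp [edgeList] at h
    | cons q e' =>
      obtain ⟨e, rfl, rfl⟩ := e
      obtain ⟨e', h1, h2⟩ := e'
      simp only [edgeList, List.cons.injEq] at h
      obtain ⟨rfl, h⟩ := h
      subst h1
      rw [ih h]

theorem exists_path_of_mem {a b : G.Pt} (p : Quiver.Path a b) (e : E) (he : e ∈ G.edgeList p) :
    Nonempty (Quiver.Path (V := G.Pt) (G.tgt e) b) := by
  induction p with
  | nil => simp [edgeList] at he
  | cons p f ih =>
    simp only [edgeList, List.mem_cons] at he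
    rcases he with rfl | he
    · obtain ⟨f, h1, rfl⟩ := f
      exact ⟨Quiver.Path.nil⟩
    · obtain ⟨q⟩ := ih he
      exact ⟨q.cons f⟩

theorem edgeList_nodup {a b : G.Pt} (p : Quiver.Path a b) : (G.edgeList p).Nodup := by
  induction p with
  | nil => simp [edgeList]
  | cons p e ih =>
    rw [edgeList, List.nodup_cons]
    refine ⟨fun he => ?_, ih⟩
    obtain ⟨q⟩ := G.exists_path_of_mem p e.1 he
    obtain ⟨e, h1, rfl⟩ := e
    have h := G.acyclic _ (q.cons ⟨e, h1, rfl⟩)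
    cases h

/-- Since the network is finite and acyclic, it has finitely many paths. -/
instance finite_path (a b : G.Pt) : Finite (Quiver.Path a b) := by
  have hf : Finite {l : List E // l.length ≤ Fintype.card E} :=
    (List.finite_length_le E (Fintype.card E)).to_subtype
  exact Finite.of_injective
    (fun p : Quiver.Path a b =>
      (⟨G.edgeList p, (G.edgeList_nodup p).length_le_card⟩ :
        {l : List E // l.length ≤ Fintype.card E}))
    fun p q h => G.edgeList_injective (congrArg Subtype.val h)

instance fintype_path (a b : G.Pt) : Fintype (Quiver.Path a b) := Fintype.ofFinite _

open Classical in
/-- The oriented intersection index of an edge with the cut: crossing the cut from its right to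
its left counts `+1`, from its left to its right `-1`. -/
def edgeIndex (e : E) : ℤ := (G.cut.count (e, false) : ℤ) - G.cut.count (e, true)

/-- The oriented intersection index of a path with the cut. -/
def pathIndex {a b : G.Pt} (p : Quiver.Path a b) : ℤ := ((G.edgeList p).map G.edgeIndex).sum

/-- The `(i,j)` entry `∑_{p : i → j} z^{ind p} wt(p)` of the boundary measurement matrix, in the
path category of the network. -/
def cylinderMeasurement (K : Type w) [Field K] (z : K) (i : Fin m) (j : Fin n) :
    Mor K (G.sourcePt i) (G.sinkPt j) :=
  ∑ p : Quiver.Path (G.sourcePt i) (G.sinkPt j), z ^ G.pathIndex p • ofPath K p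

end Paths

/-! ### The torus network -/

section Torus

variable {N : ℕ} (G : PerfectCylindricalNetwork V E N N)

/-- Vertices of the network on the torus obtained by gluing the two boundary circles: the `N`
marked points, where the `i`-th sink is glued to the `i`-th source, and the internal vertices. -/
def Torus (_ : PerfectCylindricalNetwork V E N N) : Type u := Fin N ⊕ V

/-- The gluing map on vertices. -/
def glue : CylVertex V N N → G.Torus
  | .source i => Sum.inl i
  | .inner v => Sum.inr v
  | .sink j => Sum.inl j

instance : Quiver.{v} G.Torus where
  Hom a b := {e : E // G.glue (G.src e) = a ∧ G.glue (G.tgt e) = b}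

/-- The gluing map from the network on the cylinder to the network on the torus. -/
def gluing : G.Pt ⥤q G.Torus where
  obj a := G.glue a
  map {_ _} e := ⟨e.1, congrArg G.glue e.2.1, congrArg G.glue e.2.2⟩

/-- The `i`-th marked point of the torus. The category `C` of the paths in the torus network
that start and end at marked points is the full subcategory on these objects. -/
def marked (i : Fin N) : G.Torus := Sum.inl i

/-- The path in the torus network given by a path from a source to a sink. -/
def gluePath {i j : Fin N} (p : Quiver.Path (G.sourcePt i) (G.sinkPt j)) :
    Quiver.Path (G.marked i) (G.marked j) := G.gluing.mapPath p

/-- The boundary measurement matrix `B(z)`, with entries in `C`. -/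
def boundaryMeasurement (K : Type w) [Field K] (z : K) : PMat K G.marked := fun i j =>
  Mor.lift K (fun p => ofPath K (G.gluePath p))
    (G.cylinderMeasurement K z i j)

/-! ### The double bracket -/

open Classical in
/-- `1/2` if `d'` is the successor of `d` at an internal vertex, `-1/2` if it is the predecessor,
and `0` otherwise. -/
def cornerCoeff (K : Type w) [Field K] (d d' : E × Bool) : K :=
  (if (∃ v, G.dartVertex d = .inner v) ∧ G.rot d = d' then 1 / 2 else 0) -
    (if (∃ v, G.dartVertex d' = .inner v) ∧ G.rot d' = d then 1 / 2 else 0)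

open Classical in
/-- The local double bracket, a sum of contributions of the internal vertices.
At a white vertex with darts `x₁, x₂, x₃` in counterclockwise order, `x₃` incoming, it is
`{{x₁, x₂}} = (1/2) x₁ ⊗ x₂`; at a black vertex with darts `y₁, y₂, y₃` in counterclockwise order,
`y₃` outgoing, it is `{{y₁, y₂}} = -(1/2) y₂ ⊗ y₁`; these are extended by skew-symmetry, and the
remaining brackets of edges vanish. -/
def edgeBracket (K : Type w) [Field K] : ArrowBracket K G.Torus := fun a b c d e h =>
  (if H : a = c then
    G.cornerCoeff K (e.1, false) (h.1, false) •
      (ofPath K (Quiver.Hom.toPath (⟨e.1, e.2.1.trans H, e.2.2⟩ : c ⟶ b)) ⊗ₜ[K]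
        ofPath K (Quiver.Hom.toPath (⟨h.1, h.2.1.trans H.symm, h.2.2⟩ : a ⟶ d)))
    else 0) -
  (if H : b = d then
    G.cornerCoeff K (e.1, true) (h.1, true) •
      (ofPath K (Quiver.Hom.toPath (⟨h.1, h.2.1, h.2.2.trans H.symm⟩ : c ⟶ b)) ⊗ₜ[K]
        ofPath K (Quiver.Hom.toPath (⟨e.1, e.2.1, e.2.2.trans H⟩ : a ⟶ d)))
    else 0)

theorem cornerCoeff_swap (K : Type w) [Field K] (d d' : E × Bool) :
    G.cornerCoeff K d d' = -G.cornerCoeff K d' d := by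
  simp [cornerCoeff]

theorem edgeBracket_skew (K : Type w) [Field K] ⦃a b c d : G.Torus⦄ (e : a ⟶ b) (h : c ⟶ d) :
    G.edgeBracket K e h =
      -TensorProduct.comm K (Mor K a d) (Mor K c b) (G.edgeBracket K h e) := by
  unfold edgeBracket
  rw [G.cornerCoeff_swap K (e.1, false), G.cornerCoeff_swap K (e.1, true)]
  by_cases h1 : a = c
  · by_cases h2 : b = d
    · simp [h1, h2, neg_add_eq_sub]
    · simp [h1, h2, Ne.symm h2]
  · by_cases h2 : b = d
    · simp [h1, h2, Ne.symm h1]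
    · simp [h1, h2, Ne.symm h1, Ne.symm h2]

/-- The double bracket of the torus network (and hence of its full subcategory `C`). -/
def doubleBracket (K : Type w) [Field K] : DoubleBracket K G.Torus :=
  DoubleBracket.ofArrows (G.edgeBracket K) (G.edgeBracket_skew K)

/-- The induced `H₀`-Poisson bracket `C_♮ ⊗ C → C`. -/
def hBracket (K : Type w) [Field K] (i j : Fin N) : CyclicSpace K G.marked →ₗ[K]
    Mor K (G.marked i) (G.marked j) →ₗ[K] Mor K (G.marked i) (G.marked j) :=
  (G.doubleBracket K).hBracket G.marked i j

end Torus

end PerfectCylindricalNetwork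

/-! ## The trigonometric `r`-matrix -/

/-- The field `ℂ(λ, μ)` of rational functions in the spectral parameters. -/
abbrev SpectralField : Type := FractionRing (MvPolynomial (Fin 2) ℂ)

/-- The spectral parameter `λ`. -/
def specLam : SpectralField := algebraMap (MvPolynomial (Fin 2) ℂ) SpectralField (MvPolynomial.X 0)

/-- The spectral parameter `μ`. -/
def specMu : SpectralField := algebraMap (MvPolynomial (Fin 2) ℂ) SpectralField (MvPolynomial.X 1)

/-- The trigonometric `r`-matrix
`(1/2) (y+x)/(y-x) ∑_a E_aa ⊠ E_aa + 1/(y-x) ∑_{a<b} (x E_ab ⊠ E_ba + y E_ba ⊠ E_ab)`. -/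
def trigRMatrix {K : Type w} [Field K] (N : ℕ) (x y : K) :
    Matrix (Fin N × Fin N) (Fin N × Fin N) K :=
  (1 / 2 * ((y + x) / (y - x))) •
      ∑ a : Fin N, Matrix.kronecker (Matrix.single a a 1) (Matrix.single a a 1) +
    (1 / (y - x)) • ∑ a : Fin N, ∑ b ∈ Finset.Ioi a,
      (x • Matrix.kronecker (Matrix.single a b 1) (Matrix.single b a 1) +
        y • Matrix.kronecker (Matrix.single b a 1) (Matrix.single a b 1))

/-- The coefficient `ρ_{ab}(x,y)` of `E_ab ⊠ E_ba` in the trigonometric `r`-matrix. -/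
def trigRho {K : Type w} [Field K] (N : ℕ) (x y : K) (a b : Fin N) : K :=
  trigRMatrix N x y (a, b) (b, a)

theorem trigRho_eq {K : Type w} [Field K] (N : ℕ) (x y : K) (a b : Fin N) :
    trigRho N x y a b =
      if a = b then 1 / 2 * ((y + x) / (y - x))
      else if a < b then x / (y - x) else y / (y - x) := by
  have h1 : ∀ c : Fin N, Matrix.kronecker (Matrix.single c c (1 : K)) (Matrix.single c c 1)
      (a, b) (b, a) = if c = a ∧ c = b then 1 else 0 := by
    intro c
    by_cases hc : c = a <;> by_cases hd : c = b <;> simp [Matrix.kronecker, Matrix.single, hc, hd]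
  have h2 : ∀ c d : Fin N, Matrix.kronecker (Matrix.single c d (1 : K)) (Matrix.single d c 1)
      (a, b) (b, a) = if c = a ∧ d = b then 1 else 0 := by
    intro c d
    by_cases hc : c = a <;> by_cases hd : d = b <;> simp [Matrix.kronecker, Matrix.single, hc, hd]
  simp only [trigRho, trigRMatrix, Matrix.add_apply, Matrix.smul_apply, Matrix.sum_apply, h1, h2,
    smul_eq_mul]
  have h3 : ∀ u v : Fin N, ∑ c : Fin N, ∑ d ∈ Finset.Ioi c, (if c = u ∧ d = v then (1 : K) else 0)
      = if u < v then 1 else 0 := by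
    intro u v
    rw [Finset.sum_eq_single u (fun c _ hc => by simp [hc]) (by simp)]
    simp
  have h4 : ∑ c : Fin N, ∑ d ∈ Finset.Ioi c, (if d = a ∧ c = b then (1 : K) else 0)
      = if b < a then 1 else 0 := by
    rw [← h3 b a]
    exact Finset.sum_congr rfl fun c _ => Finset.sum_congr rfl fun d _ => by simp only [and_comm]
  have h5 : ∑ c : Fin N, (if c = a ∧ c = b then (1 : K) else 0) = if a = b then 1 else 0 := by
    rw [Finset.sum_eq_single a (fun c _ hc => by simp [hc]) (by simp)]
    simp
  simp only [Finset.sum_add_distrib, ← Finset.mul_sum, h4, h3, h5]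
  rcases lt_trichotomy a b with h | h | h
  · simp [h, h.ne, h.not_gt]; ring
  · simp [h]
  · simp [h, h.ne', h.not_gt]; ring

/-- The matrix `M(x,y;k)`, with entries `M_{ab} = k ρ_{ba}(x,y) (B(x)^k)_{ab}`. -/
def PerfectCylindricalNetwork.laxM {V : Type u} {E : Type v} [Fintype V] [Fintype E] {N : ℕ}
    (G : PerfectCylindricalNetwork V E N N) {K : Type w} [Field K] (x y : K) (k : ℕ) :
    PMat K G.marked := fun a b =>
  ((k : K) * trigRho N x y b a) • PMat.pow (G.boundaryMeasurement K x) k a b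

end NCNetwork

end

noncomputable section

namespace NCNetwork

universe u v w

/-!
A double bracket of the form `{{B(λ), B(μ)}} = [r(λ, μ), B(λ) ⊗ B(μ)]` yields the Lax equation by
the Leibniz rules and the cyclicity of the trace, so the point is the bracket of two boundary
measurements.

The difference of the unit flows of two paths `p`, `q` has no sources or sinks on the sphere
obtained by collapsing the boundary circles, hence it is the coboundary of a height function on the
faces. At a common vertex of `p` and `q` this height measures the difference of the intersection
indices of the parts of the paths before the vertex. The bracket exchanges these parts, so every
corner at which `p` meets `q` contributes `± 1/2` times a power of `μ / λ` whose exponent is a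
height. The sum of these contributions along `q` telescopes, and the two boundary terms are the
entries of `r(λ, μ)`.
-/

/-! ### Matrices over a path category -/

section Lax

variable {K : Type w} [Field K] {Q : Type u} [Quiver.{v} Q]

theorem concat_nil_left {a b : Q} (f : Mor K a b) :
    concat K a a b (ofPath K Quiver.Path.nil) f = f :=
  LinearMap.congr_fun lmul_nil f

theorem concat_nil_right {a b : Q} (f : Mor K a b) :
    concat K a b b f (ofPath K Quiver.Path.nil) = f :=
  LinearMap.congr_fun rmul_nil f

namespace PMat

variable {ι : Type}

theorem one_self [DecidableEq ι] (x : ι → Q) (i : ι) :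
    one K x i i = ofPath K Quiver.Path.nil := by
  simp [one]

theorem one_of_ne [DecidableEq ι] (x : ι → Q) {i j : ι} (h : i ≠ j) : one K x i j = 0 := by
  simp [one, h]

variable [Fintype ι] {x : ι → Q}

protected theorem mul_assoc (A B C : PMat K x) : mul (mul A B) C = mul A (mul B C) := by
  funext i l
  simp only [mul, map_sum, LinearMap.sum_apply, concat_assoc]
  exact Finset.sum_comm

variable [DecidableEq ι]

protected theorem one_mul (A : PMat K x) : mul (one K x) A = A := by
  funext i l
  rw [mul, Finset.sum_eq_single i (fun j _ hj => by simp [one_of_ne x (Ne.symm hj)]) (by simp),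
    one_self, concat_nil_left]

protected theorem mul_one (A : PMat K x) : mul A (one K x) = A := by
  funext i l
  rw [mul, Finset.sum_eq_single l (fun j _ hj => by simp [one_of_ne x hj]) (by simp),
    one_self, concat_nil_right]

protected theorem pow_zero (A : PMat K x) : pow A 0 = one K x := rfl

protected theorem pow_succ (A : PMat K x) (n : ℕ) : pow A (n + 1) = mul (pow A n) A := rfl

protected theorem pow_one (A : PMat K x) : pow A 1 = A := PMat.one_mul A

theorem pow_mul_pow (A : PMat K x) (m n : ℕ) : mul (pow A m) (pow A n) = pow A (m + n) := by
  induction n with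
  | zero => exact PMat.mul_one _
  | succ n ih => rw [← add_assoc, PMat.pow_succ, PMat.pow_succ, ← PMat.mul_assoc, ih]

protected theorem pow_succ' (A : PMat K x) (n : ℕ) : pow A (n + 1) = mul A (pow A n) := by
  rw [add_comm, ← pow_mul_pow, PMat.pow_one]

end PMat

/-- The linear map `v ⊗ w ↦ (u ↦ v u w)`, which plugs a morphism between the two factors of the
value of a double bracket. -/
def sandwich (K : Type w) [Field K] (c b a d : Q) :
    Mor K c b ⊗[K] Mor K a d →ₗ[K] Mor K b a →ₗ[K] Mor K c d :=
  TensorProduct.lift (LinearMap.mk₂ K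
    (fun v w => ((concat K c a d).flip w).comp (concat K c b a v))
    (fun v v' w => by ext; simp) (fun r v w => by ext; simp)
    (fun v w w' => by ext; simp) (fun r v w => by ext; simp))

theorem sandwich_tmul {a b c d : Q} (v : Mor K c b) (w : Mor K a d) (u : Mor K b a) :
    sandwich K c b a d (v ⊗ₜ w) u = concat K c a d (concat K c b a v u) w := by
  simp [sandwich]

theorem sandwich_map_lmul {a a' b c d : Q} (f : Mor K a a') (t : Mor K c b ⊗[K] Mor K a' d)
    (u : Mor K b a) :
    sandwich K c b a d (TensorProduct.map LinearMap.id (lmul K d f) t) u =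
      sandwich K c b a' d t (concat K b a a' u f) := by
  induction t using TensorProduct.induction_on with
  | zero => simp
  | tmul v w => simp [sandwich_tmul, concat_assoc]
  | add s t hs ht => simp only [map_add, LinearMap.add_apply, hs, ht]

theorem sandwich_map_rmul {a b b' c d : Q} (f : Mor K b' b) (t : Mor K c b' ⊗[K] Mor K a d)
    (u : Mor K b a) :
    sandwich K c b a d (TensorProduct.map (rmul K c f) LinearMap.id t) u =
      sandwich K c b' a d t (concat K b' b a f u) := by
  induction t using TensorProduct.induction_on with
  | zero => simp
  | tmul v w => simp [sandwich_tmul, concat_assoc]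
  | add s t hs ht => simp only [map_add, LinearMap.add_apply, hs, ht]

theorem sandwich_nil {a c d : Q} (t : Mor K c a ⊗[K] Mor K a d) :
    sandwich K c a a d t (ofPath K Quiver.Path.nil) = TensorProduct.lift (concat K c a d) t := by
  induction t using TensorProduct.induction_on with
  | zero => simp
  | tmul v w => simp [sandwich_tmul, concat_nil_right]
  | add s t hs ht => simp only [map_add, LinearMap.add_apply, hs, ht]

namespace DoubleBracket

variable (D : DoubleBracket K Q) {ι : Type} [Fintype ι] {x : ι → Q} {c d : Q}

/-- The morphism `∑_{ij} {{X_ij, h}}' C_ji {{X_ij, h}}''`. For `C = 1` it is the bracket of `h`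
with the trace of `X`; a general `C` makes the Leibniz rule for products `X Y` expressible. -/
def insertion (X C : PMat K x) (h : Mor K c d) : Mor K c d :=
  ∑ i, ∑ j, sandwich K c (x j) (x i) d (D.br (x i) (x j) c d (X i j) h) (C j i)

theorem insertion_mul (X Y C : PMat K x) (h : Mor K c d) :
    D.insertion (PMat.mul X Y) C h =
      D.insertion Y (PMat.mul C X) h + D.insertion X (PMat.mul Y C) h := by
  have leibniz : D.insertion (PMat.mul X Y) C h = ∑ i, ∑ l, ∑ j,
      (sandwich K c (x l) (x j) d (D.br (x j) (x l) c d (Y j l) h)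
          (concat K _ _ _ (C l i) (X i j)) +
        sandwich K c (x j) (x i) d (D.br (x i) (x j) c d (X i j) h)
          (concat K _ _ _ (Y j l) (C l i))) := by
    simp only [insertion, PMat.mul, map_sum, LinearMap.sum_apply, D.leibniz_left, map_add,
      LinearMap.add_apply, sandwich_map_lmul, sandwich_map_rmul]
  rw [leibniz]
  simp only [Finset.sum_add_distrib, insertion, PMat.mul, map_sum]
  congr 1
  · rw [Finset.sum_comm]
    conv_rhs => rw [Finset.sum_comm]
    exact Finset.sum_congr rfl fun i _ => Finset.sum_comm
  · exact Finset.sum_congr rfl fun i _ => Finset.sum_comm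

variable [DecidableEq ι]

theorem insertion_one (C : PMat K x) (h : Mor K c d) : D.insertion (PMat.one K x) C h = 0 := by
  have := D.insertion_mul (PMat.one K x) (PMat.one K x) C h
  rwa [PMat.one_mul, PMat.mul_one, PMat.one_mul, left_eq_add] at this

theorem insertion_pow (A : PMat K x) (k m : ℕ) (h : Mor K c d) :
    D.insertion (PMat.pow A (k + 1)) (PMat.pow A m) h =
      (k + 1) • D.insertion A (PMat.pow A (k + m)) h := by
  induction k generalizing m with
  | zero => simp [PMat.pow_one]
  | succ k ih =>
    rw [PMat.pow_succ, insertion_mul, PMat.pow_mul_pow, ← PMat.pow_succ', ih, add_comm m,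
      show k + (m + 1) = k + 1 + m by ring, succ_nsmul (n := k + 1), add_comm]

theorem hBracket_cyclicTrace (X : PMat K x) (i j : ι) (h : Mor K (x i) (x j)) :
    D.hBracket x i j (PMat.cyclicTrace X) h = D.insertion X (PMat.one K x) h := by
  have trace : D.hBracket x i j (PMat.cyclicTrace X) =
      ∑ l, D.loopBracket (x l) (x i) (x j) (X l l) := by
    simp only [hBracket, PMat.cyclicTrace, Submodule.mkQ_apply, Submodule.liftQ_apply, map_sum,
      DirectSum.toModule_lof]
  rw [trace, LinearMap.sum_apply]
  refine Finset.sum_congr rfl fun l _ => ?_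
  rw [Finset.sum_eq_single l (fun m _ hm => by rw [PMat.one_of_ne x hm, map_zero]) (by simp),
    PMat.one_self, sandwich_nil]
  rfl

variable (A B : PMat K x) (ρ : ι → ι → K)
  (hAB : ∀ i j k l, D.br (x i) (x j) (x k) (x l) (A i j) (B k l) =
    ρ i k • (A k j ⊗ₜ[K] B i l) - ρ l j • (B k j ⊗ₜ[K] A i l))

include hAB

theorem insertion_pow_of_br_eq (k : ℕ) (b₁ b₂ : ι) :
    D.insertion A (PMat.pow A k) (B b₁ b₂) =
      PMat.mul (fun a b => ρ b a • PMat.pow A (k + 1) a b) B b₁ b₂ -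
        PMat.mul B (fun a b => ρ b a • PMat.pow A (k + 1) a b) b₁ b₂ := by
  simp only [PMat.mul]
  conv_rhs =>
    congr
    · simp only [PMat.pow_succ']
    · simp only [PMat.pow_succ]
  simp only [insertion, hAB, PMat.mul, map_sub, map_smul, map_sum, LinearMap.sub_apply,
    LinearMap.smul_apply, LinearMap.sum_apply, sandwich_tmul, Finset.sum_sub_distrib,
    Finset.smul_sum]
  rw [sub_right_inj.2 Finset.sum_comm]
  simp only [concat_assoc]

theorem hBracket_cyclicTrace_pow (k : ℕ) (b₁ b₂ : ι) :
    D.hBracket x b₁ b₂ (PMat.cyclicTrace (PMat.pow A k)) (B b₁ b₂) =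
      PMat.mul (fun a b => ((k : K) * ρ b a) • PMat.pow A k a b) B b₁ b₂ -
        PMat.mul B (fun a b => ((k : K) * ρ b a) • PMat.pow A k a b) b₁ b₂ := by
  rw [hBracket_cyclicTrace]
  cases k with
  | zero => simp [PMat.pow_zero, insertion_one, PMat.mul]
  | succ k =>
    rw [← PMat.pow_zero A, insertion_pow, add_zero, insertion_pow_of_br_eq D A B ρ hAB,
      ← Nat.cast_smul_eq_nsmul K]
    simp only [PMat.mul, smul_sub, Finset.smul_sum, map_smul, LinearMap.smul_apply, mul_smul]

end DoubleBracket

end Lax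

/-! ### Heights of faces -/

theorem eq_of_comp_finRotate {n : ℕ} {X : Type*} {f : Fin n → X}
    (h : ∀ i, f (finRotate n i) = f i) (i j : Fin n) : f i = f j := by
  cases n with
  | zero => exact i.elim0
  | succ n =>
    have eq_zero : ∀ i : Fin (n + 1), f i = f 0 := by
      intro i
      induction i using Fin.induction with
      | zero => rfl
      | succ i ih => rw [← ih, ← h i.castSucc, finRotate_apply, Fin.coeSucc_eq_succ]
    rw [eq_zero i, eq_zero j]

theorem ite_lt_succ {r : ℕ} (k : Fin (r + 1)) (a : Fin r) : (if k < a.succ then (1 : ℤ) else 0) =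
    (if k < a.castSucc then 1 else 0) + if k = a.castSucc then 1 else 0 := by
  have lt_iff : k < a.succ ↔ k < a.castSucc ∨ k = a.castSucc := by
    rw [← le_iff_lt_or_eq, Fin.le_castSucc_iff]
  by_cases hk : k < a.castSucc
  · simp [lt_iff, hk, hk.ne]
  · simp [lt_iff, hk]

theorem eq_of_sameCycle {α X : Type*} {σ : Equiv.Perm α} {f : α → X} {d d' : α}
    (hf : ∀ c, σ.SameCycle d c → f (σ c) = f c) (h : σ.SameCycle d d') : f d' = f d := by
  obtain ⟨n, rfl⟩ := h
  induction n using Int.induction_on with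
  | zero => rfl
  | succ n ih =>
    rw [← ih, ← hf _ ⟨n, rfl⟩, add_comm, zpow_add, zpow_one, Equiv.Perm.mul_apply]
  | pred n ih =>
    rw [← ih, ← hf _ ⟨-n - 1, rfl⟩, ← Equiv.Perm.mul_apply, ← zpow_one_add, add_sub_cancel]

namespace RibbonNetwork

variable {V : Type u} {E : Type v} {m n : ℕ} (G : RibbonNetwork V E m n)

/-- The vertex of a dart as an object of the path category. -/
def dartPt (d : E × Bool) : G.Pt := G.dartVertex d

/-- An edge as an arrow of the path category. -/
def arrow (e : E) : G.dartPt (e, false) ⟶ G.dartPt (e, true) := ⟨e, rfl, rfl⟩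

/-- A function on the faces of the network, encoded as a function `h` on darts (`h d` is the value
on the face to the left of `d`), that increases by `z e` when one crosses the edge `e` from left
to right. -/
structure IsHeight {A : Type*} [AddCommGroup A] (z : E → A) (h : E × Bool → A) : Prop where
  face : ∀ d, h (G.facePerm d) = h d
  jump : ∀ e, h (e, true) = h (e, false) + z e

namespace IsHeight

variable {G} {A : Type*} [AddCommGroup A] {z : E → A} {h : E × Bool → A} (H : G.IsHeight z h)
include H

theorem sub {z' : E → A} {h' : E × Bool → A} (H' : G.IsHeight z' h') :
    G.IsHeight (fun e => z e - z' e) (fun d => h d - h' d) where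
  face d := by rw [H.face, H'.face]
  jump e := by rw [H.jump, H'.jump]; abel

theorem flip_rot (d : E × Bool) : h (flip (G.rot d)) = h d := by
  rw [← H.face]
  exact congrArg h (G.facePerm.apply_symm_apply d)

theorem rot_head {d : E × Bool} {e : E} (hd : G.rot d = (e, true)) : h (e, true) = h d + z e := by
  rw [H.jump, ← H.flip_rot d, hd]
  rfl

theorem rot_tail {d : E × Bool} {e : E} (hd : G.rot d = (e, false)) :
    h (e, false) = h d - z e := by
  rw [← H.flip_rot d, hd, flip, Bool.not_false, H.jump, add_sub_cancel_right]

theorem rot_of_eq_zero {d : E × Bool} (hd : z (G.rot d).1 = 0) : h (G.rot d) = h d := by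
  obtain ⟨⟨e, _ | _⟩, hr⟩ : ∃ d', G.rot d = d' := ⟨_, rfl⟩ <;> rw [hr] at hd ⊢
  · rw [H.rot_tail hr, hd, sub_zero]
  · rw [H.rot_head hr, hd, add_zero]

theorem eq_of_sameCycle_rot {d d' : E × Bool} (hz : ∀ c, G.rot.SameCycle d c → z c.1 = 0)
    (hd : G.rot.SameCycle d d') : h d' = h d :=
  eq_of_sameCycle (fun _ hc => H.rot_of_eq_zero (hz _ (Equiv.Perm.sameCycle_apply_right.2 hc))) hd

theorem eq_of_sameFace {d d' : E × Bool} (hd : G.SameFace d d') : h d' = h d :=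
  eq_of_sameCycle (fun c _ => H.face c) hd

theorem flip_eq (d : E × Bool) : h (flip d) = h d + if d.2 then -z d.1 else z d.1 := by
  obtain ⟨e, _ | _⟩ := d
  · exact H.jump e
  · simp [flip, H.jump e]

open Classical in
theorem sum_count_smul [Fintype E] {l : List (E × Bool)} {d d' : E × Bool}
    (hl : G.IsTransversalCurve d l d') :
    ∑ e, ((l.count (e, false) : ℤ) - l.count (e, true)) • z e = h d' - h d := by
  induction l generalizing d with
  | nil => simp [H.eq_of_sameFace hl]
  | cons c l ih =>
    obtain ⟨hdc, hl⟩ := hl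
    have crossing : ∑ e, ((if c = (e, false) then 1 else 0) -
        (if c = (e, true) then 1 else 0) : ℤ) • z e = h (flip c) - h c := by
      rw [H.flip_eq]
      obtain ⟨e, _ | _⟩ := c <;> simp
    rw [← H.eq_of_sameFace hdc, ← sub_add_sub_cancel (h d') (h (flip c)), ← ih hl, ← crossing,
      ← Finset.sum_add_distrib]
    refine Finset.sum_congr rfl fun e _ => ?_
    rw [← add_smul]
    simp only [List.count_cons, beq_iff_eq]
    push_cast
    congr 1
    ring

end IsHeight

end RibbonNetwork

/-! ### Paths as unit flows -/

namespace PerfectCylindricalNetwork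

variable {V : Type u} {E : Type v} [Fintype V] [Fintype E] {m n : ℕ}
  (G : PerfectCylindricalNetwork V E m n)

section Paths

theorem edgeList_comp {a b c : G.Pt} (p : Quiver.Path a b) (q : Quiver.Path b c) :
    G.edgeList (p.comp q) = G.edgeList q ++ G.edgeList p := by
  induction q with
  | nil => rfl
  | cons q e ih => rw [Quiver.Path.comp_cons, edgeList, edgeList, ih, List.cons_append]

theorem length_edgeList {a b : G.Pt} (p : Quiver.Path a b) :
    (G.edgeList p).length = p.length := by
  induction p with
  | nil => rfl
  | cons p e ih => rw [edgeList, List.length_cons, ih, Quiver.Path.length_cons]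

theorem length_le_card_edges {a b : G.Pt} (p : Quiver.Path a b) : p.length ≤ Fintype.card E :=
  G.length_edgeList p ▸ (G.edgeList_nodup p).length_le_card

theorem exists_path_dart_of_mem {a b : G.Pt} {p : Quiver.Path a b} {d : E × Bool}
    (hd : d.1 ∈ G.edgeList p) :
    Nonempty (Quiver.Path a (G.dartPt d)) ∧ Nonempty (Quiver.Path (G.dartPt d) b) := by
  induction p with
  | nil => simp [edgeList] at hd
  | cons p f ih =>
    rw [edgeList, List.mem_cons] at hd
    rcases hd with hd | hd
    · obtain ⟨f, rfl, rfl⟩ := f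
      obtain ⟨e, _ | _⟩ := d <;> obtain rfl : e = f := hd
      · exact ⟨⟨p⟩, ⟨(G.arrow e).toPath⟩⟩
      · exact ⟨⟨p.cons (G.arrow e)⟩, ⟨Quiver.Path.nil⟩⟩
    · obtain ⟨hl, ⟨q⟩⟩ := ih hd
      exact ⟨hl, ⟨q.cons f⟩⟩

theorem not_nonempty_path_of_arrow {a b : G.Pt} (f : a ⟶ b) : ¬Nonempty (Quiver.Path b a) :=
  fun ⟨p⟩ => Quiver.Path.cons_ne_nil p f (G.acyclic _ _)

theorem pathIndex_comp {a b c : G.Pt} (p : Quiver.Path a b) (q : Quiver.Path b c) :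
    G.pathIndex (p.comp q) = G.pathIndex p + G.pathIndex q := by
  simp [pathIndex, edgeList_comp, add_comm]

theorem pathIndex_cons {a b c : G.Pt} (p : Quiver.Path a b) (f : b ⟶ c) :
    G.pathIndex (p.cons f) = G.pathIndex p + G.edgeIndex f.1 := by
  simp [pathIndex, edgeList, add_comm]

theorem src_sourceEdge (i : Fin m) : G.src (G.sourceEdge i) = .source i :=
  (G.src_eq_source _ i).2 rfl

theorem tgt_sinkEdge (j : Fin n) : G.tgt (G.sinkEdge j) = .sink j :=
  (G.tgt_eq_sink _ j).2 rfl

theorem eq_sinkPt_or_exists_arrow (a : G.Pt) :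
    (∃ j, a = G.sinkPt j) ∨ ∃ b : G.Pt, Nonempty (a ⟶ b) := by
  obtain i | v | j := a
  · exact .inr ⟨_, ⟨G.sourceEdge i, G.src_sourceEdge i, rfl⟩⟩
  · obtain ⟨e, he⟩ := G.exists_out v
    exact .inr ⟨_, ⟨e, he, rfl⟩⟩
  · exact .inl ⟨j, rfl⟩

theorem exists_path_sinkPt (a : G.Pt) : ∃ j, Nonempty (Quiver.Path a (G.sinkPt j)) := by
  by_contra! hsink
  have exists_length : ∀ k, ∃ (b : G.Pt) (p : Quiver.Path a b), p.length = k := by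
    intro k
    induction k with
    | zero => exact ⟨a, Quiver.Path.nil, rfl⟩
    | succ k ih =>
      obtain ⟨b, p, rfl⟩ := ih
      obtain ⟨j, rfl⟩ | ⟨c, ⟨f⟩⟩ := G.eq_sinkPt_or_exists_arrow b
      · exact (hsink j).elim p
      · exact ⟨c, p.cons f, rfl⟩
  obtain ⟨b, p, hp⟩ := exists_length (Fintype.card E + 1)
  exact absurd (G.length_le_card_edges p) (by omega)

end Paths

section Flow

open Classical in
/-- The number of times that a path uses an edge: the path as a unit flow. -/
def flow {a b : G.Pt} (p : Quiver.Path a b) (e : E) : ℤ := (G.edgeList p).count e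

theorem flow_comp {a b c : G.Pt} (p : Quiver.Path a b) (q : Quiver.Path b c) (e : E) :
    G.flow (p.comp q) e = G.flow p e + G.flow q e := by
  simp [flow, edgeList_comp, add_comm]

open Classical in
theorem flow_cons {a b c : G.Pt} (p : Quiver.Path a b) (f : b ⟶ c) (e : E) :
    G.flow (p.cons f) e = G.flow p e + if f.1 = e then 1 else 0 := by
  simp [flow, edgeList, List.count_cons]

theorem flow_nonneg {a b : G.Pt} (p : Quiver.Path a b) (e : E) : 0 ≤ G.flow p e := by
  simp [flow]

theorem flow_le_one {a b : G.Pt} (p : Quiver.Path a b) (e : E) : G.flow p e ≤ 1 := by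
  classical
  rw [flow]
  exact_mod_cast List.nodup_iff_count_le_one.1 (G.edgeList_nodup p) e

theorem flow_eq_zero_or_one {a b : G.Pt} (p : Quiver.Path a b) (e : E) :
    G.flow p e = 0 ∨ G.flow p e = 1 := by
  have := G.flow_nonneg p e
  have := G.flow_le_one p e
  omega

theorem mem_edgeList_of_flow_ne_zero {a b : G.Pt} {p : Quiver.Path a b} {e : E}
    (h : G.flow p e ≠ 0) : e ∈ G.edgeList p := by
  classical
  rw [flow] at h
  exact List.count_pos_iff.1 (Nat.pos_of_ne_zero (by exact_mod_cast h))

variable {A : Type*} [AddCommGroup A]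

theorem sum_flow_smul {a b : G.Pt} (p : Quiver.Path a b) (f : E → A) :
    ∑ e, G.flow p e • f e = ((G.edgeList p).map f).sum := by
  classical
  induction p with
  | nil => simp [flow, edgeList]
  | cons p e ih =>
    simp [flow_cons, add_smul, Finset.sum_add_distrib, ih, edgeList, add_comm]

theorem sum_flow_smul_sub {a b : G.Pt} (p : Quiver.Path a b) (φ : CylVertex V m n → A) :
    ∑ e, G.flow p e • (φ (G.tgt e) - φ (G.src e)) = φ b - φ a := by
  rw [sum_flow_smul]
  induction p with
  | nil => simp [edgeList]
  | cons p e ih =>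
    obtain ⟨e, rfl, rfl⟩ := e
    simp [edgeList, ih]

open Classical in
theorem sum_flow_mul_incidence {a b : G.Pt} (p : Quiver.Path a b) (x : CylVertex V m n) :
    ∑ e, G.flow p e * ((if G.tgt e = x then 1 else 0) - (if G.src e = x then 1 else 0)) =
      (if b = x then 1 else 0) - (if a = x then 1 else 0) :=
  G.sum_flow_smul_sub p (fun y => if y = x then (1 : ℤ) else 0)

open Classical in
theorem flow_sourceEdge {a b : G.Pt} (p : Quiver.Path a b) (i : Fin m) :
    G.flow p (G.sourceEdge i) =
      (if a = G.sourcePt i then 1 else 0) - (if b = G.sourcePt i then 1 else 0) := by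
  have balance := G.sum_flow_mul_incidence p (.source i)
  simp only [G.tgt_ne_source, G.src_eq_source, mul_neg, mul_ite, mul_one, mul_zero, if_false,
    zero_sub, Finset.sum_neg_distrib, Finset.sum_ite_eq', Finset.mem_univ, if_true] at balance
  rw [← neg_inj, balance, neg_sub]
  rfl

open Classical in
theorem flow_sinkEdge {a b : G.Pt} (p : Quiver.Path a b) (j : Fin n) :
    G.flow p (G.sinkEdge j) =
      (if b = G.sinkPt j then 1 else 0) - (if a = G.sinkPt j then 1 else 0) := by
  have balance := G.sum_flow_mul_incidence p (.sink j)
  simp only [G.src_ne_sink, G.tgt_eq_sink, mul_ite, mul_one, mul_zero, if_false, sub_zero,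
    Finset.sum_ite_eq', Finset.mem_univ, if_true] at balance
  exact balance

end Flow

end PerfectCylindricalNetwork

/-! ### Existence of heights -/

theorem finrank_ker_le_one {K ι M : Type*} [Field K] [AddCommGroup M] [Module K M]
    {f : (ι → K) →ₗ[K] M} (hf : ∀ φ, f φ = 0 → ∀ x y, φ x = φ y) :
    Module.finrank K (LinearMap.ker f) ≤ 1 := by
  have ker_le : LinearMap.ker f ≤ K ∙ (1 : ι → K) := fun φ hφ => by
    rw [Submodule.mem_span_singleton]
    cases isEmpty_or_nonempty ι with
    | inl _ => exact ⟨0, Subsingleton.elim _ _⟩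
    | inr h => exact ⟨φ h.some, funext fun x => (mul_one _).trans (hf φ hφ _ _)⟩
  calc Module.finrank K (LinearMap.ker f) ≤ Module.finrank K (K ∙ (1 : ι → K)) :=
        Submodule.finrank_mono ker_le
    _ ≤ 1 := (finrank_span_le_card _).trans (by simp)

theorem mem_of_dotProduct_eq_zero {K ι : Type*} [Field K] [LinearOrder K] [IsStrictOrderedRing K]
    [Fintype ι] {W W' : Submodule K (ι → K)} (hWW' : ∀ w ∈ W, ∀ w' ∈ W', w ⬝ᵥ w' = 0)
    (hdim : Fintype.card ι ≤ Module.finrank K W + Module.finrank K W') {z : ι → K}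
    (hz : ∀ w' ∈ W', z ⬝ᵥ w' = 0) : z ∈ W := by
  have disjoint : Disjoint W W' :=
    Submodule.disjoint_def.2 fun w hw hw' => dotProduct_self_eq_zero.1 (hWW' w hw w hw')
  have sup_eq_top : W ⊔ W' = ⊤ := by
    refine Submodule.eq_top_of_disjoint W W' ?_ disjoint
    rwa [Module.finrank_fintype_fun_eq_card]
  obtain ⟨w, hw, w', hw', rfl⟩ := Submodule.mem_sup.1 (sup_eq_top ▸ Submodule.mem_top : z ∈ W ⊔ W')
  have w'_eq_zero : w' = 0 := by
    rw [← dotProduct_self_eq_zero, ← hz w' hw', add_dotProduct, hWW' w hw w' hw', zero_add]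
  rwa [w'_eq_zero, add_zero]

namespace PerfectCylindricalNetwork

variable {V : Type u} {E : Type v} [Fintype V] [Fintype E] {m n : ℕ}

section Collapse

/-- The vertices after collapsing the boundary circles to points: the source circle becomes
`inl false`, the sink circle `inl true`. -/
def collapse : CylVertex V m n → Bool ⊕ V
  | .source _ => Sum.inl false
  | .inner v => Sum.inr v
  | .sink _ => Sum.inl true

variable (G : PerfectCylindricalNetwork V E m n)

theorem dart_eq_sourceEdge {d : E × Bool} {i : Fin m} (h : G.dartVertex d = .source i) :
    d = (G.sourceEdge i, false) := by
  obtain ⟨e, _ | _⟩ := d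
  · rw [(G.src_eq_source e i).1 h]
  · exact absurd h (G.tgt_ne_source e i)

theorem dart_eq_sinkEdge {d : E × Bool} {j : Fin n} (h : G.dartVertex d = .sink j) :
    d = (G.sinkEdge j, true) := by
  obtain ⟨e, _ | _⟩ := d
  · exact absurd h (G.src_ne_sink e j)
  · rw [(G.tgt_eq_sink e j).1 h]

theorem dartVertex_rot_of_inner {d : E × Bool} {v : V} (h : G.dartVertex d = .inner v) :
    G.dartVertex (G.rot d) = .inner v :=
  (G.rot_inner v d _ h).1 (Equiv.Perm.sameCycle_apply_right.2 (Equiv.Perm.SameCycle.refl _ _))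

theorem collapse_dartVertex_rot (d : E × Bool) :
    collapse (G.dartVertex (G.rot d)) = collapse (G.dartVertex d) := by
  cases h : G.dartVertex d with
  | inner v => rw [G.dartVertex_rot_of_inner h]
  | source i =>
    rw [G.dart_eq_sourceEdge h]
    obtain ⟨i, rfl⟩ := (finRotate m).surjective i
    rw [G.rot_source, RibbonNetwork.dartVertex, G.src_sourceEdge]
    rfl
  | sink i =>
    rw [G.dart_eq_sinkEdge h, G.rot_sink, RibbonNetwork.dartVertex, G.tgt_sinkEdge]
    rfl

theorem sameCycle_rot_of_dartVertex_eq {d d' : E × Bool}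
    (h : G.dartVertex d' = G.dartVertex d) : G.rot.SameCycle d d' := by
  cases hd : G.dartVertex d with
  | inner v => exact (G.rot_inner v d d' hd).2 (h.trans hd)
  | source i => rw [G.dart_eq_sourceEdge hd, G.dart_eq_sourceEdge (h.trans hd)]
  | sink j => rw [G.dart_eq_sinkEdge hd, G.dart_eq_sinkEdge (h.trans hd)]

end Collapse

section Constancy

variable {G : PerfectCylindricalNetwork V E m n} {A : Type*} [AddCommGroup A] {z : E → A}
  {h : E × Bool → A} (H : G.IsHeight z h)
include H

theorem height_eq_of_dartVertex_eq {d d' : E × Bool}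
    (hz : ∀ c, G.dartPt c = G.dartPt d → z c.1 = 0) (hd : G.dartPt d' = G.dartPt d) :
    h d' = h d := by
  cases hv : G.dartVertex d with
  | inner v =>
    exact H.eq_of_sameCycle_rot (fun c hc => hz c (((G.rot_inner v d c hv).1 hc).trans hv.symm))
      (G.sameCycle_rot_of_dartVertex_eq hd)
  | source i => rw [G.dart_eq_sourceEdge hv, G.dart_eq_sourceEdge (hd.trans hv)]
  | sink j => rw [G.dart_eq_sinkEdge hv, G.dart_eq_sinkEdge (hd.trans hv)]

/-- Along a path that meets no flow, one never crosses the flow, not even at the vertices. -/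
theorem height_eq_of_path {a b : G.Pt} (r : Quiver.Path a b) {d d' : E × Bool}
    (hz : ∀ c, Nonempty (Quiver.Path a (G.dartPt c)) → Nonempty (Quiver.Path (G.dartPt c) b) →
      z c.1 = 0)
    (hd : G.dartPt d = a) (hd' : G.dartPt d' = b) : h d' = h d := by
  induction r generalizing d' with
  | nil =>
    subst hd
    exact height_eq_of_dartVertex_eq H
      (fun c hc => hz c (hc ▸ ⟨Quiver.Path.nil⟩) (hc ▸ ⟨Quiver.Path.nil⟩)) hd'
  | cons r f ih =>
    obtain ⟨f, rfl, rfl⟩ := f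
    have tail : h (f, false) = h d :=
      ih (fun c hac ⟨q⟩ => hz c hac ⟨q.cons (G.arrow f)⟩) rfl
    rw [← tail, ← add_zero (h (f, false)), ← hz (f, false) ⟨r⟩ ⟨(G.arrow f).toPath⟩, ← H.jump]
    refine height_eq_of_dartVertex_eq H (fun c hc => ?_) hd'
    exact hz c (hc ▸ ⟨r.cons (G.arrow f)⟩) (hc ▸ ⟨Quiver.Path.nil⟩)

theorem height_sourceEdge_eq (hz : ∀ i, z (G.sourceEdge i) = 0) (i i' : Fin m) :
    h (G.sourceEdge i, false) = h (G.sourceEdge i', false) :=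
  eq_of_comp_finRotate (f := fun i => h (G.sourceEdge i, false))
    (fun i => by rw [← G.rot_source i, H.rot_of_eq_zero (G.rot_source i ▸ hz i)]) i i'

theorem height_sinkEdge_eq (hz : ∀ j, z (G.sinkEdge j) = 0) (j j' : Fin n) :
    h (G.sinkEdge j, true) = h (G.sinkEdge j', true) :=
  eq_of_comp_finRotate (f := fun j => h (G.sinkEdge j, true))
    (fun j => by rw [← G.rot_sink j, H.rot_of_eq_zero (G.rot_sink j ▸ hz _)]) j j'

end Constancy

section Existence

variable (G : PerfectCylindricalNetwork V E m n)

theorem eq_of_isHeight_zero {A : Type*} [AddCommGroup A] {h : E × Bool → A}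
    (H : G.IsHeight 0 h) (d d' : E × Bool) : h d = h d' := by
  obtain ⟨j, ⟨p⟩⟩ := G.exists_path_sinkPt (G.dartPt d)
  obtain ⟨j', ⟨p'⟩⟩ := G.exists_path_sinkPt (G.dartPt d')
  rw [← height_eq_of_path H p (d' := (G.sinkEdge j, true)) (fun _ _ _ => rfl) rfl
      (G.tgt_sinkEdge j),
    ← height_eq_of_path H p' (d' := (G.sinkEdge j', true)) (fun _ _ _ => rfl) rfl
      (G.tgt_sinkEdge j'),
    height_sinkEdge_eq H (fun _ => rfl) j j']

theorem eq_of_path {X : Type*} {φ : CylVertex V m n → X}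
    (hφ : ∀ e, φ (G.tgt e) = φ (G.src e)) {a b : G.Pt} (p : Quiver.Path a b) : φ b = φ a := by
  induction p with
  | nil => rfl
  | cons p f ih =>
    obtain ⟨f, rfl, rfl⟩ := f
    exact (hφ f).trans ih

/-- The faces of the network on the sphere obtained by collapsing the boundary circles. -/
abbrev Face : Type v := Quotient (Equiv.Perm.SameCycle.setoid G.facePerm)

/-- The face to the left of a dart. -/
def leftFace (d : E × Bool) : G.Face := Quotient.mk _ d

theorem leftFace_facePerm (d : E × Bool) : G.leftFace (G.facePerm d) = G.leftFace d :=
  Quotient.sound (Equiv.Perm.sameCycle_apply_left.2 (Equiv.Perm.SameCycle.refl _ _))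

/-- The coboundary operator from functions on the faces, that is, on the vertices of the dual
graph, to functions on the edges. -/
def faceCoboundary : (G.Face → ℚ) →ₗ[ℚ] (E → ℚ) :=
  LinearMap.funLeft ℚ ℚ (fun e => G.leftFace (e, true)) -
    LinearMap.funLeft ℚ ℚ (fun e => G.leftFace (e, false))

/-- The coboundary operator from functions on the collapsed vertices to functions on the edges. -/
def vertexCoboundary : (Bool ⊕ V → ℚ) →ₗ[ℚ] (E → ℚ) :=
  LinearMap.funLeft ℚ ℚ (fun e => collapse (G.tgt e)) -
    LinearMap.funLeft ℚ ℚ (fun e => collapse (G.src e))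

theorem faceCoboundary_apply (η : G.Face → ℚ) (e : E) :
    G.faceCoboundary η e = η (G.leftFace (e, true)) - η (G.leftFace (e, false)) :=
  rfl

theorem vertexCoboundary_apply (φ : Bool ⊕ V → ℚ) (e : E) :
    G.vertexCoboundary φ e = φ (collapse (G.tgt e)) - φ (collapse (G.src e)) :=
  rfl

theorem isHeight_faceCoboundary (η : G.Face → ℚ) :
    G.IsHeight (G.faceCoboundary η) fun d => η (G.leftFace d) where
  face d := by rw [leftFace_facePerm]
  jump e := by rw [faceCoboundary_apply, add_sub_cancel]

theorem faceCoboundary_dotProduct_vertexCoboundary (η : G.Face → ℚ) (φ : Bool ⊕ V → ℚ) :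
    G.faceCoboundary η ⬝ᵥ G.vertexCoboundary φ = 0 := by
  have flip_invariant : ∑ d, η (G.leftFace d) * φ (collapse (G.dartVertex d)) =
      ∑ d, η (G.leftFace d) * φ (collapse (G.dartVertex (RibbonNetwork.flip d))) := by
    rw [← Equiv.sum_comp G.facePerm]
    refine Finset.sum_congr rfl fun d _ => ?_
    rw [leftFace_facePerm, ← G.collapse_dartVertex_rot (G.facePerm d)]
    simp [RibbonNetwork.facePerm]
  simp only [Fintype.sum_prod_type, Fintype.sum_bool, RibbonNetwork.flip,
    RibbonNetwork.dartVertex, Bool.not_true, Bool.not_false] at flip_invariant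
  rw [← sub_eq_zero, ← Finset.sum_sub_distrib] at flip_invariant
  rw [← flip_invariant]
  refine Finset.sum_congr rfl fun e _ => ?_
  rw [faceCoboundary_apply, vertexCoboundary_apply]
  ring

theorem finrank_ker_faceCoboundary_le :
    Module.finrank ℚ (LinearMap.ker G.faceCoboundary) ≤ 1 := by
  refine finrank_ker_le_one fun η hη f f' => ?_
  obtain ⟨d, rfl⟩ := Quotient.exists_rep f
  obtain ⟨d', rfl⟩ := Quotient.exists_rep f'
  exact G.eq_of_isHeight_zero (hη ▸ G.isHeight_faceCoboundary η) d d'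

theorem finrank_ker_vertexCoboundary_le [NeZero m] :
    Module.finrank ℚ (LinearMap.ker G.vertexCoboundary) ≤ 1 := by
  refine finrank_ker_le_one fun φ hφ x y => ?_
  have eq_sink (a : G.Pt) : φ (collapse a) = φ (.inl true) := by
    obtain ⟨j, ⟨p⟩⟩ := G.exists_path_sinkPt a
    exact (G.eq_of_path (φ := fun a => φ (collapse a))
      (fun e => sub_eq_zero.1 (congrFun hφ e)) p).symm
  have const : ∀ x, φ x = φ (.inl true)
    | .inl false => eq_sink (G.sourcePt 0)
    | .inl true => rfl
    | .inr v => eq_sink (.inner v)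
  rw [const x, const y]

theorem card_edges_le_finrank_add_finrank [NeZero m] :
    Fintype.card E ≤ Module.finrank ℚ (LinearMap.range G.faceCoboundary) +
      Module.finrank ℚ (LinearMap.range G.vertexCoboundary) := by
  have := Fintype.ofFinite G.Face
  have face_rank := LinearMap.finrank_range_add_finrank_ker G.faceCoboundary
  have vertex_rank := LinearMap.finrank_range_add_finrank_ker G.vertexCoboundary
  simp only [Module.finrank_fintype_fun_eq_card, Fintype.card_sum, Fintype.card_bool]
    at face_rank vertex_rank
  have face_ker := G.finrank_ker_faceCoboundary_le
  have vertex_ker := G.finrank_ker_vertexCoboundary_le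
  have euler : ((Fintype.card V + 2 : ℕ) : ℤ) - Fintype.card E + Nat.card G.Face = 2 := G.euler
  rw [Nat.card_eq_fintype_card] at euler
  omega

/-- By the Euler characteristic of the sphere, the coboundaries of functions on the faces fill the
orthogonal complement of the coboundaries of functions on the vertices. -/
theorem exists_isHeight_rat [NeZero m] {z : E → ℚ}
    (hz : ∀ φ : Bool ⊕ V → ℚ, z ⬝ᵥ G.vertexCoboundary φ = 0) : ∃ h, G.IsHeight z h := by
  obtain ⟨η, rfl⟩ : z ∈ LinearMap.range G.faceCoboundary := by
    refine mem_of_dotProduct_eq_zero ?_ G.card_edges_le_finrank_add_finrank ?_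
    · rintro _ ⟨η, rfl⟩ _ ⟨φ, rfl⟩
      exact G.faceCoboundary_dotProduct_vertexCoboundary η φ
    · rintro _ ⟨φ, rfl⟩
      exact hz φ
  exact ⟨_, G.isHeight_faceCoboundary η⟩

theorem exists_isHeight [NeZero m] {a b a' b' : G.Pt} (p : Quiver.Path a b)
    (q : Quiver.Path a' b') (ha : collapse a = collapse a') (hb : collapse b = collapse b') :
    ∃ h, G.IsHeight (fun e => G.flow p e - G.flow q e) h := by
  obtain ⟨h, H⟩ := G.exists_isHeight_rat (z := fun e => ((G.flow p e - G.flow q e : ℤ) : ℚ))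
    fun φ => by
      have flow_p := G.sum_flow_smul_sub p fun x => φ (collapse x)
      have flow_q := G.sum_flow_smul_sub q fun x => φ (collapse x)
      rw [← sub_eq_zero.2 (congrArg₂ (fun x y => φ x - φ y) hb ha), ← flow_p, ← flow_q,
        ← Finset.sum_sub_distrib]
      refine Finset.sum_congr rfl fun e _ => ?_
      rw [vertexCoboundary_apply, ← sub_smul, zsmul_eq_mul]
  refine ⟨fun d => ⌊h d⌋, fun d => congrArg _ (H.face d), fun e => ?_⟩
  rw [← Int.floor_add_intCast, ← H.jump]

end Existence

end PerfectCylindricalNetwork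

/-! ### Heights and intersection indices -/

namespace PerfectCylindricalNetwork

variable {V : Type u} {E : Type v} [Fintype V] [Fintype E] {m n : ℕ}

section Index

variable (G : PerfectCylindricalNetwork V E m n)

theorem pathIndex_eq_sum {a b : G.Pt} (p : Quiver.Path a b) :
    G.pathIndex p = ∑ e, G.edgeIndex e * G.flow p e := by
  rw [pathIndex, ← sum_flow_smul]
  exact Finset.sum_congr rfl fun e _ => mul_comm _ _

theorem flow_eq_zero_of_path_from_tgt {a x y : G.Pt} (p : Quiver.Path a x) (g : x ⟶ y)
    {d : E × Bool} (r : Quiver.Path y (G.dartPt d)) : G.flow p d.1 = 0 := by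
  by_contra h
  obtain ⟨-, ⟨q⟩⟩ := G.exists_path_dart_of_mem (G.mem_edgeList_of_flow_ne_zero h)
  exact G.not_nonempty_path_of_arrow g ⟨r.comp q⟩

theorem flow_eq_zero_of_path_to_src {x y b : G.Pt} (g : x ⟶ y) (p : Quiver.Path y b)
    {d : E × Bool} (r : Quiver.Path (G.dartPt d) x) : G.flow p d.1 = 0 := by
  by_contra h
  obtain ⟨⟨q⟩, -⟩ := G.exists_path_dart_of_mem (G.mem_edgeList_of_flow_ne_zero h)
  exact G.not_nonempty_path_of_arrow g ⟨q.comp r⟩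

theorem flow_sinkEdge_eq_zero {a x y : G.Pt} (p : Quiver.Path a x) (g : x ⟶ y) (j : Fin n) :
    G.flow p (G.sinkEdge j) = 0 := by
  have x_ne : x ≠ G.sinkPt j := fun hx => G.src_ne_sink g.1 j (g.2.1.trans hx)
  have nonneg := G.flow_nonneg p (G.sinkEdge j)
  rw [G.flow_sinkEdge, if_neg x_ne] at nonneg ⊢
  split_ifs at nonneg ⊢ <;> omega

theorem flow_sourceEdge_eq_zero {x y b : G.Pt} (g : x ⟶ y) (p : Quiver.Path y b) (i : Fin m) :
    G.flow p (G.sourceEdge i) = 0 := by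
  have y_ne : y ≠ G.sourcePt i := fun hy => G.tgt_ne_source g.1 i (g.2.2.trans hy)
  have nonneg := G.flow_nonneg p (G.sourceEdge i)
  rw [G.flow_sourceEdge, if_neg y_ne] at nonneg ⊢
  split_ifs at nonneg ⊢ <;> omega

theorem height_eq_sinkEdge [NeZero n] {a a' x y : G.Pt} {j : Fin n} (p : Quiver.Path a x)
    (q : Quiver.Path a' x) (g : x ⟶ y) (r : Quiver.Path y (G.sinkPt j)) {h : E × Bool → ℤ}
    (H : G.IsHeight (fun e => G.flow p e - G.flow q e) h) :
    h (g.1, false) = h (G.sinkEdge 0, false) := by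
  obtain ⟨g, rfl, rfl⟩ := g
  have zero_downstream (c : E × Bool) (s : Quiver.Path (G.dartPt (g, true)) (G.dartPt c)) :
      G.flow p c.1 - G.flow q c.1 = 0 :=
    sub_eq_zero.2 ((G.flow_eq_zero_of_path_from_tgt p (G.arrow g) s).trans
      (G.flow_eq_zero_of_path_from_tgt q (G.arrow g) s).symm)
  have zero_sinkEdge (j : Fin n) : G.flow p (G.sinkEdge j) - G.flow q (G.sinkEdge j) = 0 :=
    sub_eq_zero.2 ((G.flow_sinkEdge_eq_zero p (G.arrow g) j).trans
      (G.flow_sinkEdge_eq_zero q (G.arrow g) j).symm)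
  have along_path : h (G.sinkEdge j, true) = h (g, true) :=
    height_eq_of_path H r (fun c ⟨s⟩ _ => zero_downstream c s) rfl (G.tgt_sinkEdge j)
  have across_edge := H.jump g
  have across_sinkEdge := H.jump (G.sinkEdge 0)
  rw [zero_downstream (g, true) Quiver.Path.nil, add_zero] at across_edge
  rw [zero_sinkEdge, add_zero] at across_sinkEdge
  rw [← across_edge, ← along_path, ← across_sinkEdge, height_sinkEdge_eq H zero_sinkEdge j 0]

theorem height_eq_sourceEdge [NeZero m] {i : Fin m} {x y b b' : G.Pt}
    (r : Quiver.Path (G.sourcePt i) x) (g : x ⟶ y) (p : Quiver.Path y b)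
    (q : Quiver.Path y b') {h : E × Bool → ℤ}
    (H : G.IsHeight (fun e => G.flow p e - G.flow q e) h) :
    h (g.1, false) = h (G.sourceEdge 0, false) := by
  obtain ⟨g, rfl, rfl⟩ := g
  have zero_upstream (c : E × Bool) (s : Quiver.Path (G.dartPt c) (G.dartPt (g, false))) :
      G.flow p c.1 - G.flow q c.1 = 0 :=
    sub_eq_zero.2 ((G.flow_eq_zero_of_path_to_src (G.arrow g) p s).trans
      (G.flow_eq_zero_of_path_to_src (G.arrow g) q s).symm)
  have zero_sourceEdge (i : Fin m) :
      G.flow p (G.sourceEdge i) - G.flow q (G.sourceEdge i) = 0 :=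
    sub_eq_zero.2 ((G.flow_sourceEdge_eq_zero (G.arrow g) p i).trans
      (G.flow_sourceEdge_eq_zero (G.arrow g) q i).symm)
  rw [height_sourceEdge_eq H zero_sourceEdge 0 i]
  exact height_eq_of_path H r (fun c _ ⟨s⟩ => zero_upstream c s) (G.src_sourceEdge i) rfl

variable [NeZero m] [NeZero n]

theorem pathIndex_sub_eq {a b a' b' : G.Pt} (p : Quiver.Path a b) (q : Quiver.Path a' b')
    {h : E × Bool → ℤ} (H : G.IsHeight (fun e => G.flow p e - G.flow q e) h) :
    G.pathIndex p - G.pathIndex q = h (G.sinkEdge 0, false) - h (G.sourceEdge 0, false) := by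
  rw [← H.sum_count_smul (G.isCut 0 0 rfl rfl), pathIndex_eq_sum, pathIndex_eq_sum,
    ← Finset.sum_sub_distrib]
  exact Finset.sum_congr rfl fun e _ => (mul_sub _ _ _).symm

/-- The flows of the initial parts and of the final parts have heights of their own. At the common
edge the first one has already reached its value at the sinks, and the second one still has its
value at the sources. -/
theorem pathIndex_sub_eq_of_common_arrow {i k : Fin m} {j l : Fin n} {x y : G.Pt} (g : x ⟶ y)
    (p₁ : Quiver.Path (G.sourcePt i) x) (p₂ : Quiver.Path y (G.sinkPt j))
    (q₁ : Quiver.Path (G.sourcePt k) x) (q₂ : Quiver.Path y (G.sinkPt l)) {h : E × Bool → ℤ}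
    (H : G.IsHeight (fun e => G.flow ((p₁.cons g).comp p₂) e -
      G.flow ((q₁.cons g).comp q₂) e) h) :
    G.pathIndex p₁ - G.pathIndex q₁ = h (g.1, false) - h (G.sourceEdge 0, false) := by
  obtain ⟨h₁, H₁⟩ := G.exists_isHeight p₁ q₁ rfl rfl
  have H₂ : G.IsHeight (fun e => G.flow p₂ e - G.flow q₂ e) (fun d => h d - h₁ d) := by
    convert H.sub H₁ using 2 with e
    simp only [flow_comp, flow_cons]
    ring
  have before := G.height_eq_sinkEdge p₁ q₁ g p₂ H₁
  have after := G.height_eq_sourceEdge p₁ g p₂ q₂ H₂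
  rw [G.pathIndex_sub_eq p₁ q₁ H₁]
  linarith

end Index

end PerfectCylindricalNetwork

/-! ### Corners at internal vertices -/

theorem two_mul_sub_one_mul_half_zpow {K : Type*} [Field K] {t : K} (ht : t ≠ 0)
    (h2 : (2 : K) ≠ 0) {f : ℤ} (hf : f = 0 ∨ f = 1) (r : ℤ) :
    2 * (t - 1) * ((f : K) * (1 / 2 * t ^ r)) = t ^ (r + f) - t ^ r := by
  rcases hf with rfl | rfl
  · simp
  · rw [zpow_add_one₀ ht]
    push_cast
    field_simp

namespace PerfectCylindricalNetwork

variable {V : Type u} {E : Type v} [Fintype V] [Fintype E] {m n : ℕ}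

section Vertex

variable (G : PerfectCylindricalNetwork V E m n) {v : V} {d : E × Bool}

theorem minimalPeriod_rot (hd : G.dartVertex d = .inner v) :
    Function.minimalPeriod G.rot d = 3 := by
  have orbit_eq : MulAction.orbit (Subgroup.zpowers G.rot) d =
      {d' | G.dartVertex d' = .inner v} := by
    ext d'
    rw [Set.mem_ofPred_eq, ← G.rot_inner v d d' hd]
    exact ⟨fun ⟨⟨_, k, hk⟩, h⟩ => ⟨k, by subst hk; exact h⟩, fun ⟨k, h⟩ => ⟨⟨_, k, rfl⟩, h⟩⟩
  have card_orbit := Nat.card_congr (MulAction.orbitZPowersEquiv G.rot d)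
  rw [Nat.card_zmod, orbit_eq, Nat.card_coe_set_eq, G.trivalent] at card_orbit
  exact card_orbit.symm

theorem rot_rot_rot (hd : G.dartVertex d = .inner v) : G.rot (G.rot (G.rot d)) = d := by
  have periodic := Function.iterate_minimalPeriod (f := G.rot) (x := d)
  rwa [G.minimalPeriod_rot hd] at periodic

theorem rot_ne_self (hd : G.dartVertex d = .inner v) : G.rot d ≠ d := fun h =>
  absurd ((G.minimalPeriod_rot hd).symm.trans (Function.minimalPeriod_eq_one_iff_isFixedPt.2 h))
    (by decide)

theorem rot_rot_ne_self (hd : G.dartVertex d = .inner v) : G.rot (G.rot d) ≠ d := fun h =>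
  G.rot_ne_self hd ((congrArg G.rot h).symm.trans (G.rot_rot_rot hd))

open Classical in
theorem filter_dartVertex_eq (hd : G.dartVertex d = .inner v) :
    Finset.univ.filter (fun d' => G.dartVertex d' = .inner v) =
      {d, G.rot d, G.rot (G.rot d)} := by
  have hd₁ := G.dartVertex_rot_of_inner hd
  have hd₂ := G.dartVertex_rot_of_inner hd₁
  symm
  refine Finset.eq_of_subset_of_card_le (fun d' hd' => ?_) (le_of_eq ?_)
  · simp only [Finset.mem_insert, Finset.mem_singleton] at hd'
    rcases hd' with rfl | rfl | rfl <;> simp [*]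
  · rw [Finset.card_eq_three.2 ⟨d, _, _, (G.rot_ne_self hd).symm, (G.rot_rot_ne_self hd).symm,
      (G.rot_ne_self hd₁).symm, rfl⟩, ← G.trivalent v, ← Set.ncard_coe_finset]
    simp

theorem rot_eq_or_rot_eq {d' : E × Bool} (hd : G.dartVertex d = .inner v)
    (hd' : G.dartVertex d' = .inner v) (hne : d ≠ d') : G.rot d = d' ∨ G.rot d' = d := by
  classical
  have mem : d' ∈ Finset.univ.filter (fun d' => G.dartVertex d' = .inner v) := by simp [hd']
  rw [G.filter_dartVertex_eq hd] at mem
  simp only [Finset.mem_insert, Finset.mem_singleton] at mem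
  rcases mem with rfl | rfl | rfl
  · exact absurd rfl hne
  · exact .inl rfl
  · exact .inr (G.rot_rot_rot hd)

/-- The flow of a path through a dart into its vertex. -/
def inflow {a b : G.Pt} (p : Quiver.Path a b) (d : E × Bool) : ℤ :=
  if d.2 then G.flow p d.1 else -G.flow p d.1

theorem inflow_add_inflow_add_inflow {a b : G.Pt} (p : Quiver.Path a b)
    (hd : G.dartVertex d = .inner v) (ha : a ≠ CylVertex.inner v) (hb : b ≠ CylVertex.inner v) :
    G.inflow p d + G.inflow p (G.rot d) + G.inflow p (G.rot (G.rot d)) = 0 := by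
  classical
  have hd₁ := G.dartVertex_rot_of_inner hd
  have sum_darts : ∑ d' with G.dartVertex d' = .inner v, G.inflow p d' = 0 := by
    have balance := G.sum_flow_mul_incidence p (.inner v)
    rw [if_neg ha, if_neg hb, sub_zero] at balance
    rw [Finset.sum_filter, Fintype.sum_prod_type, ← balance]
    refine Finset.sum_congr rfl fun e _ => ?_
    simp only [Fintype.sum_bool, RibbonNetwork.dartVertex, inflow]
    split_ifs <;> simp_all
  rwa [G.filter_dartVertex_eq hd, Finset.sum_insert, Finset.sum_pair, ← add_assoc] at sum_darts
  · exact (G.rot_ne_self hd₁).symm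
  · simp [(G.rot_ne_self hd).symm, (G.rot_rot_ne_self hd).symm]

end Vertex

section Corners

variable (G : PerfectCylindricalNetwork V E m n) {K : Type w} [Field K] (t : K) (h : E × Bool → ℤ)

open Classical in
/-- The contribution `cornerCoeff` of a pair of darts at an internal vertex, where each of the two
terms is weighted by `t` to the height of the face to the left of the second dart in
counterclockwise order. -/
def cornerWeight (d d' : E × Bool) : K :=
  (if (∃ v, G.dartVertex d = .inner v) ∧ G.rot d = d' then 1 / 2 * t ^ h d' else 0) -
    (if (∃ v, G.dartVertex d' = .inner v) ∧ G.rot d' = d then 1 / 2 * t ^ h d else 0)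

/-- The sum of the corner weights of a dart `d` with the darts of a path, in the direction
of `d`. -/
def cornerSum {a b : G.Pt} (p : Quiver.Path a b) (d : E × Bool) : K :=
  ∑ e, (G.flow p e : K) * G.cornerWeight t h (e, d.2) d

/-- The quantity that telescopes along a path when its corner sums are added up. -/
def edgePotential (e : E) : K := t ^ h (e, false) + t ^ (h (e, true) + 1)

variable {t h} {G}

theorem flow_eq_one_of_mem {a b : G.Pt} {p : Quiver.Path a b} {e : E} (he : e ∈ G.edgeList p) :
    G.flow p e = 1 := by
  classical
  rw [flow, List.count_eq_one_of_mem (G.edgeList_nodup p) he, Nat.cast_one]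

theorem exists_eq_inner {a b c : G.Pt} (f : a ⟶ b) (g : b ⟶ c) : ∃ v, b = CylVertex.inner v := by
  obtain ⟨f, rfl, rfl⟩ := f
  rcases hb : G.tgt f with i | v | j
  · exact absurd hb (G.tgt_ne_source f i)
  · exact ⟨v, rfl⟩
  · exact absurd (g.2.1.trans hb) (G.src_ne_sink g.1 j)

theorem dartVertex_eq_of_rot_eq {d d' : E × Bool} {v : V} (hd : G.dartVertex d = .inner v)
    (hr : G.rot d = d') : G.dartVertex d = G.dartVertex d' := by
  rw [← hr, hd, G.dartVertex_rot_of_inner hd]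

theorem cornerWeight_eq_zero {d d' : E × Bool} (hd : G.dartVertex d ≠ G.dartVertex d') :
    G.cornerWeight t h d d' = 0 := by
  rw [cornerWeight, if_neg fun ⟨⟨_, hv⟩, hr⟩ => hd (dartVertex_eq_of_rot_eq hv hr),
    if_neg fun ⟨⟨_, hv⟩, hr⟩ => hd (dartVertex_eq_of_rot_eq hv hr).symm, sub_zero]

theorem cornerSum_of_not_inner {a b : G.Pt} (p : Quiver.Path a b) {d : E × Bool}
    (hd : ∀ v, G.dartVertex d ≠ .inner v) : G.cornerSum t h p d = 0 := by
  refine Finset.sum_eq_zero fun e _ => mul_eq_zero_of_right _ ?_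
  rw [cornerWeight, if_neg fun ⟨⟨v, hv⟩, hr⟩ =>
      hd v ((dartVertex_eq_of_rot_eq hv hr).symm.trans hv),
    if_neg fun ⟨⟨v, hv⟩, _⟩ => hd v hv, sub_zero]

theorem sum_flow_mul_ite_dart {a b : G.Pt} (p : Quiver.Path a b) (s : Bool) (d : E × Bool)
    [∀ e : E, Decidable ((e, s) = d)] (c : E × Bool → K) :
    ∑ e, (G.flow p e : K) * (if (e, s) = d then c (e, s) else 0) =
      if d.2 = s then (G.flow p d.1 : K) * c d else 0 := by
  split_ifs with hs
  · subst hs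
    rw [Finset.sum_eq_single d.1]
    · rw [if_pos rfl]
    · exact fun e _ he => by rw [if_neg (fun hd => he (congrArg Prod.fst hd)), mul_zero]
    · simp
  · exact Finset.sum_eq_zero fun e _ => by
      rw [if_neg (fun hd => hs (congrArg Prod.snd hd).symm), mul_zero]

theorem cornerSum_eq {a b : G.Pt} (p : Quiver.Path a b) {x d y : E × Bool} {v : V}
    (hd : G.dartVertex d = .inner v) (hx : G.rot x = d) (hy : G.rot d = y) :
    G.cornerSum t h p d = (if x.2 = d.2 then (G.flow p x.1 : K) * (1 / 2 * t ^ h d) else 0) -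
      (if y.2 = d.2 then (G.flow p y.1 : K) * (1 / 2 * t ^ h y) else 0) := by
  classical
  have before (c : E × Bool) : (∃ v, G.dartVertex c = .inner v) ∧ G.rot c = d ↔ c = x := by
    rw [← hx, G.rot.injective.eq_iff, and_iff_right_iff_imp]
    rintro rfl
    refine ⟨v, ?_⟩
    rw [← G.rot_rot_rot hd] at hx
    rw [G.rot.injective hx]
    exact G.dartVertex_rot_of_inner (G.dartVertex_rot_of_inner hd)
  have after (c : E × Bool) : (∃ v, G.dartVertex d = .inner v) ∧ G.rot d = c ↔ c = y := by
    rw [hy, and_iff_right ⟨v, hd⟩, eq_comm]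
  simp only [cornerSum, cornerWeight, before, after, mul_sub, Finset.sum_sub_distrib]
  rw [sum_flow_mul_ite_dart p d.2 x fun _ => 1 / 2 * t ^ h d,
    sum_flow_mul_ite_dart p d.2 y fun c => 1 / 2 * t ^ h c]

variable (ht : t ≠ 0) (h2 : (2 : K) ≠ 0) {k i : Fin m} {j l : Fin n}
  {p : Quiver.Path (G.sourcePt k) (G.sinkPt j)} {q : Quiver.Path (G.sourcePt i) (G.sinkPt l)}
  (H : G.IsHeight (fun e => G.flow p e - G.flow q e) h)
include ht h2 H

theorem edgePotential_sub_of_rot_head_eq {g g' : E} {v : V} (hg : G.dartVertex (g, true) = .inner v)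
    (hrot : G.rot (g, true) = (g', false)) (hq : G.flow q g = 1) (hq' : G.flow q g' = 1) :
    edgePotential t h g - edgePotential t h g' =
      2 * (t - 1) * (G.cornerSum t h p (g, true) + G.cornerSum t h p (g', false)) := by
  obtain ⟨⟨x, s⟩, hx⟩ : ∃ d, G.rot (g', false) = d := ⟨_, rfl⟩
  have hx' : G.rot (x, s) = (g, true) := by rw [← hx, ← hrot, G.rot_rot_rot hg]
  have hg' : G.dartVertex (g', false) = .inner v := hrot ▸ G.dartVertex_rot_of_inner hg
  have conservation_p := G.inflow_add_inflow_add_inflow p hg nofun nofun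
  have conservation_q := G.inflow_add_inflow_add_inflow q hg nofun nofun
  have hf := G.flow_eq_zero_or_one p x
  have hfg := G.flow_eq_zero_or_one p g
  have hfg' := G.flow_eq_zero_or_one p g'
  have face := H.rot_tail hrot
  have face' := H.rot_head hx'
  have jump := H.jump g
  have jump' := H.jump g'
  rw [G.cornerSum_eq p hg hx' hrot, G.cornerSum_eq p hg' hrot hx]
  rw [hrot, hx] at conservation_p conservation_q
  simp only [edgePotential]
  cases s <;> simp only [inflow, if_true, Bool.false_eq_true, if_false, reduceCtorEq, sub_zero,
    zero_sub, zero_add, add_zero, mul_neg, two_mul_sub_one_mul_half_zpow ht h2 hf, neg_sub]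
    at conservation_p conservation_q ⊢
  · have := H.rot_tail hx
    rw [show h (g', false) = h (x, false) + G.flow p x by omega,
      show h (g', true) = h (g, true) by omega, show h (g, false) = h (x, false) by omega]
    ring
  · have := H.rot_head hx
    rw [show h (g', true) = h (g, true) by omega, show h (g, false) = h (g', false) + G.flow p x by
      omega]
    rcases hf with hf | hf
    · simp [hf]
    · rw [show h (g, true) = h (g', false) by omega]
      ring

theorem edgePotential_sub_of_rot_tail_eq {g g' : E} {v : V} (hg : G.dartVertex (g, true) = .inner v)
    (hrot : G.rot (g', false) = (g, true)) (hq : G.flow q g = 1) (hq' : G.flow q g' = 1) :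
    edgePotential t h g - edgePotential t h g' =
      2 * (t - 1) * (G.cornerSum t h p (g, true) + G.cornerSum t h p (g', false)) := by
  obtain ⟨⟨x, s⟩, hx⟩ : ∃ d, G.rot (g, true) = d := ⟨_, rfl⟩
  have hx' : G.rot (x, s) = (g', false) := by
    rw [← hx]
    exact G.rot.injective ((G.rot_rot_rot hg).trans hrot.symm)
  have hg' : G.dartVertex (g', false) = .inner v :=
    hx' ▸ G.dartVertex_rot_of_inner (hx ▸ G.dartVertex_rot_of_inner hg)
  have conservation_p := G.inflow_add_inflow_add_inflow p hg nofun nofun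
  have conservation_q := G.inflow_add_inflow_add_inflow q hg nofun nofun
  have hf := G.flow_eq_zero_or_one p x
  have hfg := G.flow_eq_zero_or_one p g
  have hfg' := G.flow_eq_zero_or_one p g'
  have face := H.rot_head hrot
  have face' := H.rot_tail hx'
  have jump := H.jump g
  have jump' := H.jump g'
  rw [G.cornerSum_eq p hg hrot hx, G.cornerSum_eq p hg' hx' hrot]
  rw [hx, hx'] at conservation_p conservation_q
  simp only [edgePotential]
  cases s <;> simp only [inflow, if_true, Bool.false_eq_true, if_false, reduceCtorEq, sub_zero,
    zero_sub, zero_add, add_zero, mul_neg, two_mul_sub_one_mul_half_zpow ht h2 hf, neg_sub]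
    at conservation_p conservation_q ⊢
  · have := H.rot_tail hx
    rw [show h (g, false) = h (g', false) by omega, show h (g', true) = h (x, false) by omega,
      show h (g, true) = h (x, false) + G.flow p x by omega]
    rcases hf with hf | hf
    · simp [hf]
    · rw [show h (g', false) = h (x, false) + 1 by omega, hf]
      ring
  · have := H.rot_head hx
    rw [show h (g, false) = h (g', false) by omega, show h (g', true) = h (x, true) by omega,
      show h (x, true) = h (g, true) + G.flow p x by omega]
    rcases hf with hf | hf
    · simp [hf]
    · rw [hf]
      ring

theorem edgePotential_sub {g g' : E} {v : V} (hg : G.tgt g = .inner v) (hg' : G.src g' = .inner v)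
    (hq : G.flow q g = 1) (hq' : G.flow q g' = 1) :
    edgePotential t h g - edgePotential t h g' =
      2 * (t - 1) * (G.cornerSum t h p (g, true) + G.cornerSum t h p (g', false)) := by
  rcases G.rot_eq_or_rot_eq (d := (g, true)) (d' := (g', false)) hg hg' (by simp) with hr | hr
  · exact edgePotential_sub_of_rot_head_eq ht h2 H hg hr hq hq'
  · exact edgePotential_sub_of_rot_tail_eq ht h2 H hg hr hq hq'

theorem sum_cornerSum_prefix {b c : G.Pt} (q₁ : Quiver.Path (G.sourcePt i) b) (g : b ⟶ c)
    (q₂ : Quiver.Path c (G.sinkPt l)) (hq : (q₁.cons g).comp q₂ = q) :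
    2 * (t - 1) * ((G.edgeList (q₁.cons g)).map fun e =>
        G.cornerSum t h p (e, true) + G.cornerSum t h p (e, false)).sum =
      edgePotential t h (G.sourceEdge i) - edgePotential t h g.1 +
        2 * (t - 1) * G.cornerSum t h p (g.1, true) := by
  induction q₁ generalizing c with
  | nil =>
    have hs : G.src g.1 = .source i := g.2.1
    obtain hg : g.1 = G.sourceEdge i := (G.src_eq_source _ _).1 hs
    have at_source : G.cornerSum t h p (g.1, false) = 0 :=
      cornerSum_of_not_inner p fun v hv => nomatch hs.symm.trans hv
    simp [edgeList, hg ▸ at_source, hg]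
  | @cons b d q₁ f ih =>
    have flow_f : G.flow q f.1 = 1 := flow_eq_one_of_mem (by simp [← hq, edgeList_comp, edgeList])
    have flow_g : G.flow q g.1 = 1 := flow_eq_one_of_mem (by simp [← hq, edgeList_comp, edgeList])
    obtain ⟨v, hv⟩ := exists_eq_inner f g
    have potential_sub :=
      edgePotential_sub ht h2 H (f.2.2.trans hv) (g.2.1.trans hv) flow_f flow_g
    have ih := ih f (g.toPath.comp q₂) (by rw [← Quiver.Path.comp_assoc]; exact hq)
    rw [edgeList, List.map_cons, List.sum_cons, mul_add, ih]
    linear_combination -potential_sub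

theorem sum_cornerSum :
    2 * (t - 1) * ∑ e, (G.flow q e : K) *
        (G.cornerSum t h p (e, true) + G.cornerSum t h p (e, false)) =
      edgePotential t h (G.sourceEdge i) - edgePotential t h (G.sinkEdge l) := by
  simp only [← zsmul_eq_mul, G.sum_flow_smul q]
  obtain ⟨b, q₁, g, hq⟩ : ∃ (b : G.Pt) (q₁ : Quiver.Path (G.sourcePt i) b) (g : b ⟶ G.sinkPt l),
      q = q₁.cons g :=
    (Quiver.Path.length_ne_zero_iff_eq_cons q).1 (mt q.eq_of_length_zero nofun)
  have hg : G.tgt g.1 = .sink l := g.2.2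
  have at_sink : G.cornerSum t h p (g.1, true) = 0 :=
    cornerSum_of_not_inner p fun v hv => nomatch hg.symm.trans hv
  have telescoped := sum_cornerSum_prefix ht h2 H q₁ g Quiver.Path.nil hq.symm
  rw [at_sink, mul_zero, add_zero, (G.tgt_eq_sink _ _).1 hg] at telescoped
  rw [hq, telescoped]

end Corners

section BoundaryHeights

variable {G : PerfectCylindricalNetwork V E m n} {h : E × Bool → ℤ}

variable {k i : Fin m} {j l : Fin n}
  {p : Quiver.Path (G.sourcePt k) (G.sinkPt j)} {q : Quiver.Path (G.sourcePt i) (G.sinkPt l)}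

theorem flow_sourceEdge_eq_ite (p : Quiver.Path (G.sourcePt k) (G.sinkPt j)) (a : Fin m) :
    G.flow p (G.sourceEdge a) = if k = a then 1 else 0 := by
  have source_inj : G.sourcePt k = G.sourcePt a ↔ k = a := ⟨CylVertex.source.inj, congrArg _⟩
  have sink_ne : G.sinkPt j ≠ G.sourcePt a := nofun
  simp only [flow_sourceEdge, source_inj, sink_ne, if_false, sub_zero]

theorem flow_sinkEdge_eq_ite (p : Quiver.Path (G.sourcePt k) (G.sinkPt j)) (a : Fin n) :
    G.flow p (G.sinkEdge a) = if j = a then 1 else 0 := by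
  have sink_inj : G.sinkPt j = G.sinkPt a ↔ j = a := ⟨CylVertex.sink.inj, congrArg _⟩
  have source_ne : G.sourcePt k ≠ G.sinkPt a := nofun
  simp only [flow_sinkEdge, sink_inj, source_ne, if_false, sub_zero]

variable (H : G.IsHeight (fun e => G.flow p e - G.flow q e) h)
include H

theorem height_sourceEdge [NeZero m] (a : Fin m) :
    h (G.sourceEdge a, false) = h (G.sourceEdge 0, false) + (if k < a then 1 else 0) -
      (if i < a then 1 else 0) := by
  obtain ⟨r, rfl⟩ := Nat.exists_eq_succ_of_ne_zero (NeZero.ne m)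
  induction a using Fin.induction with
  | zero => simp
  | succ a ih =>
    have across_edge := H.rot_tail (G.rot_source a.castSucc)
    rw [finRotate_apply, Fin.coeSucc_eq_succ, ih, flow_sourceEdge_eq_ite,
      flow_sourceEdge_eq_ite] at across_edge
    rw [ite_lt_succ, ite_lt_succ]
    linarith

theorem height_sinkEdge [NeZero n] (a : Fin n) :
    h (G.sinkEdge a, false) = h (G.sinkEdge 0, false) + (if j < a then 1 else 0) -
      (if l < a then 1 else 0) := by
  obtain ⟨r, rfl⟩ := Nat.exists_eq_succ_of_ne_zero (NeZero.ne n)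
  induction a using Fin.induction with
  | zero => simp
  | succ a ih =>
    have across_edge := H.rot_head (G.rot_sink a.castSucc)
    rw [finRotate_apply, Fin.coeSucc_eq_succ, H.jump, H.jump, add_left_inj, ih,
      flow_sinkEdge_eq_ite, flow_sinkEdge_eq_ite] at across_edge
    rw [ite_lt_succ, ite_lt_succ]
    linarith

end BoundaryHeights

end PerfectCylindricalNetwork

/-! ### Expanding the bracket of two paths -/

section Splits

variable {Q : Type u} [Quiver.{v} Q]

/-- A path from `a` to `b` with a distinguished arrow: the places where an edge bracket is applied
when the double bracket of two paths is expanded by the Leibniz rules. -/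
structure Split (a b : Q) where
  {tail head : Q}
  arrow : tail ⟶ head
  before : Quiver.Path a tail
  after : Quiver.Path head b

namespace Split

/-- The path underlying a path with a distinguished arrow. -/
def path {a b : Q} (s : Split a b) : Quiver.Path a b := (s.before.cons s.arrow).comp s.after

/-- Appending an arrow, the distinguished arrow being kept. -/
def cons {a b c : Q} (s : Split a b) (f : b ⟶ c) : Split a c := ⟨s.arrow, s.before, s.after.cons f⟩

/-- Cutting a path before its distinguished arrow. -/
def tailEquiv (a b : Q) :
    Split a b ≃ Σ x : Q, Quiver.Path a x × (Σ y : Q, (x ⟶ y) × Quiver.Path y b) where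
  toFun s := ⟨s.tail, s.before, s.head, s.arrow, s.after⟩
  invFun s := ⟨s.2.2.2.1, s.2.1, s.2.2.2.2⟩

/-- Cutting a path after its distinguished arrow. -/
def headEquiv (a b : Q) :
    Split a b ≃ Σ y : Q, (Σ x : Q, (x ⟶ y) × Quiver.Path a x) × Quiver.Path y b where
  toFun s := ⟨s.head, ⟨s.tail, s.arrow, s.before⟩, s.after⟩
  invFun s := ⟨s.2.1.2.1, s.2.1.2.2, s.2.2⟩

theorem path_ne_nil {a : Q} (s : Split a a) : s.path ≠ Quiver.Path.nil := fun h => by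
  have length_eq := congrArg Quiver.Path.length h
  simp [path] at length_eq

theorem path_eq_cons {a b c : Q} (p : Quiver.Path a b) (f : b ⟶ c) (s : Split a c) :
    s.path = p.cons f ↔
      s = ⟨f, p, Quiver.Path.nil⟩ ∨ ∃ s' : Split a b, s'.path = p ∧ s'.cons f = s := by
  constructor
  · obtain ⟨e, p₁, p₂⟩ := s
    intro h
    cases p₂ with
    | nil =>
      cases h
      exact .inl rfl
    | cons p₂ g =>
      cases h
      exact .inr ⟨⟨e, p₁, p₂⟩, rfl, rfl⟩
  · rintro (rfl | ⟨s', rfl, rfl⟩) <;> rfl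

theorem cons_injective {a b c : Q} (f : b ⟶ c) :
    Function.Injective fun s : Split a b => s.cons f := by
  rintro ⟨e, p₁, p₂⟩ ⟨e', p₁', p₂'⟩ h
  cases h
  rfl

theorem cons_ne {a b c : Q} (p : Quiver.Path a b) (f : b ⟶ c) (s : Split a b) :
    s.cons f ≠ ⟨f, p, Quiver.Path.nil⟩ := fun h => by
  have length_eq := congrArg (fun s : Split a c => s.after.length) h
  simp [cons] at length_eq

end Split

theorem sum_sum_sigma_eq_sum_diagonal {ι M : Type*} [Fintype ι] [AddCommMonoid M]
    {C D : ι → Type*} [∀ i, Fintype (C i)] [∀ i, Fintype (D i)]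
    (f : (Σ i, C i) → (Σ i, D i) → M) (hf : ∀ s s', s.1 ≠ s'.1 → f s s' = 0) :
    ∑ s, ∑ s', f s s' = ∑ i, ∑ c, ∑ d, f ⟨i, c⟩ ⟨i, d⟩ := by
  rw [Fintype.sum_sigma]
  refine Finset.sum_congr rfl fun i _ => Finset.sum_congr rfl fun c _ => ?_
  rw [Fintype.sum_sigma, Finset.sum_eq_single i
    (fun j _ hj => Finset.sum_eq_zero fun d _ => hf _ _ hj.symm) (by simp)]

theorem sum_sum_sigma_prod_swap {ι M : Type*} [Fintype ι] [AddCommMonoid M]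
    {A B A' B' : ι → Type*} [∀ i, Fintype (A i)] [∀ i, Fintype (B i)] [∀ i, Fintype (A' i)]
    [∀ i, Fintype (B' i)] (g : (Σ i, A i × B i) → (Σ i, A' i × B' i) → M)
    (g' : (Σ i, A' i × B i) → (Σ i, A i × B' i) → M)
    (hg : ∀ s s', s.1 ≠ s'.1 → g s s' = 0) (hg' : ∀ s s', s.1 ≠ s'.1 → g' s s' = 0)
    (swap : ∀ i a b a' b', g ⟨i, a, b⟩ ⟨i, a', b'⟩ = g' ⟨i, a', b⟩ ⟨i, a, b'⟩) :
    ∑ s, ∑ s', g s s' = ∑ s, ∑ s', g' s s' := by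
  rw [sum_sum_sigma_eq_sum_diagonal g hg, sum_sum_sigma_eq_sum_diagonal g' hg']
  refine Finset.sum_congr rfl fun i _ => ?_
  simp only [← Fintype.sum_prod_type', ← swap]
  exact Fintype.sum_equiv ((Equiv.prodProdProdComm _ _ _ _).trans
    (((Equiv.prodComm _ _).prodCongr (Equiv.refl _)).trans (Equiv.prodProdProdComm _ _ _ _))) _ _
    fun _ => rfl

variable [Fintype Q] [∀ a b : Q, Fintype (a ⟶ b)] [∀ a b : Q, Fintype (Quiver.Path a b)]

instance (a b : Q) : Fintype (Split a b) := Fintype.ofEquiv _ (Split.tailEquiv a b).symm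

namespace Split

variable {M : Type*} [AddCommMonoid M]

theorem sum_swap_tail {i j k l : Q} (g : Split i j → Split k l → M) (g' : Split k j → Split i l → M)
    (hg : ∀ s s', s.tail ≠ s'.tail → g s s' = 0) (hg' : ∀ s s', s.tail ≠ s'.tail → g' s s' = 0)
    (swap : ∀ (x y y' : Q) (e : x ⟶ y) (e' : x ⟶ y') (p₁ p₂ q₁ q₂),
      g ⟨e, p₁, p₂⟩ ⟨e', q₁, q₂⟩ = g' ⟨e, q₁, p₂⟩ ⟨e', p₁, q₂⟩) :
    ∑ s, ∑ s', g s s' = ∑ s, ∑ s', g' s s' := by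
  simp only [← (tailEquiv _ _).symm.sum_comp]
  exact sum_sum_sigma_prod_swap _
    (fun s s' => g' ((tailEquiv _ _).symm s) ((tailEquiv _ _).symm s'))
    (fun s s' => hg ((tailEquiv _ _).symm s) ((tailEquiv _ _).symm s'))
    (fun s s' => hg' ((tailEquiv _ _).symm s) ((tailEquiv _ _).symm s'))
    fun _ _ _ _ _ => swap _ _ _ _ _ _ _ _ _

theorem sum_swap_head {i j k l : Q} (g : Split i j → Split k l → M) (g' : Split k j → Split i l → M)
    (hg : ∀ s s', s.head ≠ s'.head → g s s' = 0) (hg' : ∀ s s', s.head ≠ s'.head → g' s s' = 0)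
    (swap : ∀ (x x' y : Q) (e : x ⟶ y) (e' : x' ⟶ y) (p₁ p₂ q₁ q₂),
      g ⟨e, p₁, p₂⟩ ⟨e', q₁, q₂⟩ = g' ⟨e', q₁, p₂⟩ ⟨e, p₁, q₂⟩) :
    ∑ s, ∑ s', g s s' = ∑ s, ∑ s', g' s s' := by
  simp only [← (headEquiv _ _).symm.sum_comp]
  exact sum_sum_sigma_prod_swap _
    (fun s s' => g' ((headEquiv _ _).symm s) ((headEquiv _ _).symm s'))
    (fun s s' => hg ((headEquiv _ _).symm s) ((headEquiv _ _).symm s'))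
    (fun s s' => hg' ((headEquiv _ _).symm s) ((headEquiv _ _).symm s'))
    fun _ _ _ _ _ => swap _ _ _ _ _ _ _ _ _

open Classical in
theorem sum_path_eq_nil {a : Q} (F : Split a a → M) :
    ∑ s with s.path = Quiver.Path.nil, F s = 0 := by
  rw [Finset.filter_false_of_mem fun s _ => s.path_ne_nil, Finset.sum_empty]

open Classical in
theorem sum_path_eq_cons {a b c : Q} (p : Quiver.Path a b) (f : b ⟶ c) (F : Split a c → M) :
    ∑ s with s.path = p.cons f, F s =
      F ⟨f, p, Quiver.Path.nil⟩ + ∑ s : Split a b with s.path = p, F (s.cons f) := by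
  have filter_eq : (Finset.univ.filter fun s : Split a c => s.path = p.cons f) =
      insert ⟨f, p, Quiver.Path.nil⟩
        ((Finset.univ.filter fun s : Split a b => s.path = p).map ⟨_, cons_injective f⟩) := by
    ext s
    simp [path_eq_cons]
  rw [filter_eq, Finset.sum_insert (by simp [cons_ne]), Finset.sum_map]
  rfl

open Classical in
theorem sum_path {a b : Q} (F : Quiver.Path a b → Split a b → M) :
    ∑ p, ∑ s with s.path = p, F p s = ∑ s, F s.path s := by
  rw [← Finset.sum_fiberwise Finset.univ path]
  exact Finset.sum_congr rfl fun p _ => Finset.sum_congr rfl fun s hs => by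
    rw [(Finset.mem_filter.1 hs).2]

open Classical in
theorem sum_path_path {a b c d : Q}
    (F : Quiver.Path a b → Quiver.Path c d → Split a b → Split c d → M) :
    ∑ p, ∑ q, ∑ s with s.path = p, ∑ s' with s'.path = q, F p q s s' =
      ∑ s, ∑ s', F s.path s'.path s s' := by
  rw [← sum_path fun p s => ∑ s', F p s'.path s s']
  refine Finset.sum_congr rfl fun p _ => ?_
  rw [Finset.sum_comm]
  exact Finset.sum_congr rfl fun s _ => sum_path fun q s' => F p q s s'

variable {Q' : Type*} [Quiver Q']

/-- The contribution of two distinguished arrows to the double bracket of the images of two paths,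
as a function of the bracket of the images of the arrows. -/
def extend (K : Type w) [Field K] (F : Q ⥤q Q') {a b c d : Q} (s : Split a b) (s' : Split c d) :
    Mor K (F.obj s'.tail) (F.obj s.head) ⊗[K] Mor K (F.obj s.tail) (F.obj s'.head) →ₗ[K]
      Mor K (F.obj c) (F.obj b) ⊗[K] Mor K (F.obj a) (F.obj d) :=
  TensorProduct.map
    (rmul K _ (ofPath K (F.mapPath s.after)) ∘ₗ lmul K _ (ofPath K (F.mapPath s'.before)))
    (rmul K _ (ofPath K (F.mapPath s'.after)) ∘ₗ lmul K _ (ofPath K (F.mapPath s.before)))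

end Split

variable {K : Type w} [Field K] {Q' : Type*} [Quiver Q'] (eb : ArrowBracket K Q') (F : Q ⥤q Q')

open Classical in
theorem arrowPathBr_mapPath {x y : Q'} (e : x ⟶ y) {c d : Q} (q : Quiver.Path c d) :
    arrowPathBr eb e (F.mapPath q) = ∑ s : Split c d with s.path = q,
      TensorProduct.map (lmul K _ (ofPath K (F.mapPath s.before)))
        (rmul K _ (ofPath K (F.mapPath s.after))) (eb e (F.map s.arrow)) := by
  induction q with
  | nil =>
    rw [Split.sum_path_eq_nil]
    rfl
  | cons q f ih =>
    rw [Split.sum_path_eq_cons, Prefunctor.mapPath_cons, arrowPathBr, ih, map_sum]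
    congr 1
    · simp [rmul_nil]
    · refine Finset.sum_congr rfl fun s _ => ?_
      rw [← LinearMap.comp_apply, ← TensorProduct.map_comp, ← rmul_comp, LinearMap.id_comp]
      rfl

open Classical in
theorem pathBr_mapPath {a b c d : Q} (p : Quiver.Path a b) (q : Quiver.Path c d) :
    pathBr eb (F.mapPath p) (F.mapPath q) = ∑ s : Split a b with s.path = p,
      ∑ s' : Split c d with s'.path = q, s.extend K F s' (eb (F.map s.arrow) (F.map s'.arrow)) := by
  induction p with
  | nil =>
    rw [Split.sum_path_eq_nil]
    rfl
  | cons p f ih =>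
    rw [Split.sum_path_eq_cons, Prefunctor.mapPath_cons, pathBr, ih, map_sum, arrowPathBr_mapPath,
      map_sum]
    congr 1
    · refine Finset.sum_congr rfl fun s _ => ?_
      rw [← LinearMap.comp_apply, ← TensorProduct.map_comp, LinearMap.id_comp, Split.extend,
        lmul_rmul]
      simp [rmul_nil]
    · refine Finset.sum_congr rfl fun s _ => ?_
      rw [map_sum]
      refine Finset.sum_congr rfl fun s' _ => ?_
      rw [← LinearMap.comp_apply, Split.extend, ← TensorProduct.map_comp, LinearMap.id_comp,
        ← LinearMap.comp_assoc, ← rmul_comp]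
      rfl

end Splits

/-! ### Corner contributions of two paths -/

theorem zpow_add_zpow_eq_trigRho {N : ℕ} {K : Type w} [Field K] (h2 : (2 : K) ≠ 0) {x y : K}
    (hx : x ≠ 0) (hxy : x ≠ y) (a b : Fin N) :
    (y / x) ^ (if b < a then (1 : ℤ) else 0) +
        (y / x) ^ ((if b < a then (1 : ℤ) else 0) + if b = a then 1 else 0) =
      2 * (y / x - 1) * trigRho N x y a b := by
  have hyx : y - x ≠ 0 := sub_ne_zero.2 hxy.symm
  rw [trigRho_eq]
  rcases lt_trichotomy a b with hab | rfl | hab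
  · simp only [hab.not_gt, hab.ne, hab.ne', hab, if_true, if_false, add_zero, zpow_zero]
    field_simp
    ring
  · simp only [lt_irrefl, if_true, if_false, zero_add, zpow_zero, zpow_one]
    field_simp
    ring
  · simp only [hab.not_gt, hab.ne, hab.ne', hab, if_true, if_false, add_zero, zpow_one]
    field_simp
    ring

namespace PerfectCylindricalNetwork

variable {V : Type u} {E : Type v} [Fintype V] [Fintype E]

section CornerIndex

variable {m n : ℕ} {G : PerfectCylindricalNetwork V E m n} {h : E × Bool → ℤ}

theorem rot_rot_eq {v : V} {c d : E × Bool} (hd : G.dartVertex d = .inner v)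
    (hc : G.dartVertex c = .inner v) (hcd : c ≠ d) (hcr : c ≠ G.rot d) : G.rot (G.rot d) = c := by
  rcases G.rot_eq_or_rot_eq hd hc hcd.symm with hr | hr
  · exact absurd hr.symm hcr
  · rw [← hr, G.rot_rot_rot hc]

variable [NeZero m] [NeZero n] {i k : Fin m} {j l : Fin n} {x : G.Pt}
  (p : Quiver.Path (G.sourcePt k) x) (p' : Quiver.Path x (G.sinkPt j))
  (q : Quiver.Path (G.sourcePt i) x) (q' : Quiver.Path x (G.sinkPt l))
  (H : G.IsHeight (fun e => G.flow (p.comp p') e - G.flow (q.comp q') e) h)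
include H

theorem height_rot_of_outgoing {v : V} (hx : x = CylVertex.inner v) {d : E × Bool}
    (hd : G.dartVertex d = .inner v) (outgoing : d.2 = false) (outgoing_rot : (G.rot d).2 = false) :
    h (G.rot d) - h (G.sourceEdge 0, false) = G.pathIndex p - G.pathIndex q := by
  have third {y : G.Pt} (f : y ⟶ x) : G.rot (G.rot d) = (f.1, true) :=
    rot_rot_eq hd (f.2.2.trans hx) (ne_of_apply_ne Prod.snd (by simp [outgoing]))
      (ne_of_apply_ne Prod.snd (by simp [outgoing_rot]))
  have length_ne_zero {a : Fin m} (p : Quiver.Path (G.sourcePt a) x) : p.length ≠ 0 :=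
    fun hp => nomatch (p.eq_of_length_zero hp).trans hx
  obtain ⟨y, p, f, rfl⟩ := p.length_ne_zero_iff_eq_cons.1 (length_ne_zero p)
  obtain ⟨y', q, f', rfl⟩ := q.length_ne_zero_iff_eq_cons.1 (length_ne_zero q)
  have edge_eq : f.1 = f'.1 := congrArg Prod.fst ((third f).symm.trans (third f'))
  obtain rfl : y = y' := f.2.1.symm.trans ((congrArg G.src edge_eq).trans f'.2.1)
  obtain rfl : f = f' := Subtype.ext edge_eq
  have face := H.flip_rot (G.rot d)
  rw [third f] at face
  rw [G.pathIndex_cons, G.pathIndex_cons, add_sub_add_right_eq_sub,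
    G.pathIndex_sub_eq_of_common_arrow f p p' q q' H, ← face]
  rfl

theorem height_rot_of_incoming {v : V} (hx : x = CylVertex.inner v) {d : E × Bool}
    (hd : G.dartVertex d = .inner v) (incoming : d.2 = true) (incoming_rot : (G.rot d).2 = true) :
    h (G.rot d) - h (G.sourceEdge 0, false) = G.pathIndex p - G.pathIndex q := by
  have third {y : G.Pt} (f : x ⟶ y) : G.rot (G.rot d) = (f.1, false) :=
    rot_rot_eq hd (f.2.1.trans hx) (ne_of_apply_ne Prod.snd (by simp [incoming]))
      (ne_of_apply_ne Prod.snd (by simp [incoming_rot]))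
  have length_ne_zero {a : Fin n} (p : Quiver.Path x (G.sinkPt a)) : p.length ≠ 0 :=
    fun hp => nomatch hx.symm.trans (p.eq_of_length_zero hp)
  obtain ⟨y, f, p', rfl, -⟩ := p'.length_ne_zero_iff_eq_comp.1 (length_ne_zero p')
  obtain ⟨y', f', q', rfl, -⟩ := q'.length_ne_zero_iff_eq_comp.1 (length_ne_zero q')
  have edge_eq : f.1 = f'.1 := congrArg Prod.fst ((third f).symm.trans (third f'))
  obtain rfl : y = y' := f.2.2.symm.trans ((congrArg G.tgt edge_eq).trans f'.2.2)
  obtain rfl : f = f' := Subtype.ext edge_eq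
  rw [← Quiver.Path.comp_assoc, ← Quiver.Path.comp_assoc, Quiver.Path.comp_toPath_eq_cons,
    Quiver.Path.comp_toPath_eq_cons] at H
  have face := H.flip_rot (G.rot d)
  have jump := H.jump f.1
  rw [third f] at face
  rw [flow_eq_one_of_mem (by simp [edgeList_comp, edgeList]),
    flow_eq_one_of_mem (by simp [edgeList_comp, edgeList]), sub_self, add_zero] at jump
  rw [G.pathIndex_sub_eq_of_common_arrow f p p' q q' H, ← face, ← jump]
  rfl

theorem height_rot_eq_pathIndex_sub {d : E × Bool} {v : V} (hx : x = CylVertex.inner v)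
    (hd : G.dartVertex d = .inner v) (same_direction : (G.rot d).2 = d.2) :
    h (G.rot d) - h (G.sourceEdge 0, false) = G.pathIndex p - G.pathIndex q := by
  cases direction : d.2 with
  | false =>
    exact height_rot_of_outgoing p p' q q' H hx hd direction (same_direction.trans direction)
  | true =>
    exact height_rot_of_incoming p p' q q' H hx hd direction (same_direction.trans direction)

end CornerIndex

section CornerCoeff

variable {N : ℕ} {G : PerfectCylindricalNetwork V E N N} {K : Type w} [Field K]

theorem cornerCoeff_eq_zero {d d' : E × Bool} (hd : G.dartVertex d ≠ G.dartVertex d') :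
    G.cornerCoeff K d d' = 0 := by
  rw [cornerCoeff, if_neg fun ⟨⟨_, hv⟩, hr⟩ => hd (dartVertex_eq_of_rot_eq hv hr),
    if_neg fun ⟨⟨_, hv⟩, hr⟩ => hd (dartVertex_eq_of_rot_eq hv hr).symm, sub_zero]

variable {h : E × Bool → ℤ} [NeZero N] (t : K) (h₀ : h (G.sourceEdge 0, false) = 0)
  {i j k l : Fin N}
include h₀

theorem cornerWeight_eq_cornerCoeff_mul {x : G.Pt} (p : Quiver.Path (G.sourcePt k) x)
    (p' : Quiver.Path x (G.sinkPt j)) (q : Quiver.Path (G.sourcePt i) x)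
    (q' : Quiver.Path x (G.sinkPt l))
    (H : G.IsHeight (fun e => G.flow (p.comp p') e - G.flow (q.comp q') e) h) {d d' : E × Bool}
    (hd : G.dartVertex d = x) (hd' : G.dartVertex d' = x) (same_direction : d.2 = d'.2) :
    G.cornerWeight t h d d' = G.cornerCoeff K d d' * t ^ (G.pathIndex p - G.pathIndex q) := by
  have height_eq {c c' : E × Bool} (hc : G.dartVertex c = x) (hs : c'.2 = c.2)
      (corner : (∃ v, G.dartVertex c = .inner v) ∧ G.rot c = c') :
      h c' = G.pathIndex p - G.pathIndex q := by
    obtain ⟨⟨v, hv⟩, rfl⟩ := corner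
    rw [← height_rot_eq_pathIndex_sub p p' q q' H (hc.symm.trans hv) hv hs, h₀, sub_zero]
  classical
  simp only [cornerWeight, cornerCoeff, sub_mul, ite_mul, zero_mul]
  congr 1
  · exact ite_congr rfl (fun hr => by rw [height_eq hd same_direction.symm hr]) fun _ => rfl
  · exact ite_congr rfl (fun hr => by rw [height_eq hd' same_direction hr]) fun _ => rfl

end CornerCoeff

section Finiteness

variable {m n : ℕ} (G : PerfectCylindricalNetwork V E m n)

instance finite_pt : Finite G.Pt :=
  Finite.of_surjective
    (Sum.elim .source (Sum.elim .inner .sink) : Fin m ⊕ V ⊕ Fin n → CylVertex V m n) fun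
    | .source i => ⟨.inl i, rfl⟩
    | .inner v => ⟨.inr (.inl v), rfl⟩
    | .sink j => ⟨.inr (.inr j), rfl⟩

instance fintype_pt : Fintype G.Pt := Fintype.ofFinite _

instance finite_hom (a b : G.Pt) : Finite (a ⟶ b) :=
  inferInstanceAs (Finite {e : E // G.src e = a ∧ G.tgt e = b})

instance fintype_hom (a b : G.Pt) : Fintype (a ⟶ b) := Fintype.ofFinite _

open Classical in
theorem sum_split_arrow {A : Type*} [AddCommGroup A] {a b : G.Pt} (p : Quiver.Path a b)
    (φ : E → A) : ∑ s : Split a b with s.path = p, φ s.arrow.1 = ∑ e, G.flow p e • φ e := by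
  rw [sum_flow_smul]
  induction p with
  | nil =>
    rw [Split.sum_path_eq_nil]
    rfl
  | cons p f ih =>
    rw [Split.sum_path_eq_cons, edgeList, List.map_cons, List.sum_cons, ← ih]
    rfl

end Finiteness

section SplitWeight

variable {N : ℕ} (G : PerfectCylindricalNetwork V E N N) {K : Type w} [Field K]

/-- The coefficient with which a pair of distinguished arrows of two paths contributes to the
bracket. The powers of `t` arise because the bracket exchanges the parts of the paths before the
arrows, and with them their intersections with the cut. -/
def splitWeight (t : K) {a b c d : G.Pt} (s : Split a b) (s' : Split c d) : K :=
  G.cornerCoeff K (s.arrow.1, false) (s'.arrow.1, false) *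
      t ^ (G.pathIndex s.before - G.pathIndex s'.before) +
    G.cornerCoeff K (s.arrow.1, true) (s'.arrow.1, true) *
      t ^ (G.pathIndex (s.before.cons s.arrow) - G.pathIndex (s'.before.cons s'.arrow))

variable [NeZero N] (t : K) {h : E × Bool → ℤ} (h₀ : h (G.sourceEdge 0, false) = 0)
  {k j i l : Fin N}
include h₀

theorem splitWeight_eq_cornerWeight_add (s : Split (G.sourcePt k) (G.sinkPt j))
    (s' : Split (G.sourcePt i) (G.sinkPt l))
    (H : G.IsHeight (fun e => G.flow s.path e - G.flow s'.path e) h) :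
    G.splitWeight t s s' = G.cornerWeight t h (s.arrow.1, false) (s'.arrow.1, false) +
      G.cornerWeight t h (s.arrow.1, true) (s'.arrow.1, true) := by
  obtain @⟨x, y, e, p₁, p₂⟩ := s
  obtain @⟨x', y', e', q₁, q₂⟩ := s'
  rw [splitWeight]
  congr 1
  · rcases eq_or_ne x x' with rfl | hx
    · refine (cornerWeight_eq_cornerCoeff_mul (d := (e.1, false)) (d' := (e'.1, false)) t h₀ p₁
        (e.toPath.comp p₂) q₁ (e'.toPath.comp q₂) ?_ e.2.1 e'.2.1 rfl).symm
      rwa [← Quiver.Path.comp_assoc, ← Quiver.Path.comp_assoc, Quiver.Path.comp_toPath_eq_cons,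
        Quiver.Path.comp_toPath_eq_cons]
    · have tails_ne : G.dartVertex (e.1, false) ≠ G.dartVertex (e'.1, false) :=
        fun h => hx (e.2.1.symm.trans (h.trans e'.2.1))
      rw [cornerWeight_eq_zero tails_ne, cornerCoeff_eq_zero tails_ne, zero_mul]
  · rcases eq_or_ne y y' with rfl | hy
    · exact (cornerWeight_eq_cornerCoeff_mul (d := (e.1, true)) (d' := (e'.1, true)) t h₀ _ p₂ _
        q₂ H e.2.2 e'.2.2 rfl).symm
    · have heads_ne : G.dartVertex (e.1, true) ≠ G.dartVertex (e'.1, true) :=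
        fun h => hy (e.2.2.symm.trans (h.trans e'.2.2))
      rw [cornerWeight_eq_zero heads_ne, cornerCoeff_eq_zero heads_ne, zero_mul]

variable (p : Quiver.Path (G.sourcePt k) (G.sinkPt j))
  (q : Quiver.Path (G.sourcePt i) (G.sinkPt l))

open Classical in
theorem sum_splitWeight_eq_sum_cornerSum
    (H : G.IsHeight (fun e => G.flow p e - G.flow q e) h) :
    ∑ s : Split (G.sourcePt k) (G.sinkPt j) with s.path = p,
        ∑ s' : Split (G.sourcePt i) (G.sinkPt l) with s'.path = q, G.splitWeight t s s' =
      ∑ e, (G.flow q e : K) * (G.cornerSum t h p (e, true) + G.cornerSum t h p (e, false)) := by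
  have at_corners : ∀ s' : Split (G.sourcePt i) (G.sinkPt l), s'.path = q →
      ∑ s : Split (G.sourcePt k) (G.sinkPt j) with s.path = p, G.splitWeight t s s' =
        G.cornerSum t h p (s'.arrow.1, true) + G.cornerSum t h p (s'.arrow.1, false) := by
    rintro s' rfl
    simp only [cornerSum, ← zsmul_eq_mul, ← G.sum_split_arrow p, ← Finset.sum_add_distrib]
    refine Finset.sum_congr rfl fun s hs => ?_
    obtain rfl := (Finset.mem_filter.1 hs).2
    rw [G.splitWeight_eq_cornerWeight_add t h₀ s s' H, add_comm]
  rw [Finset.sum_comm, Finset.sum_congr rfl fun s' hs' => at_corners s' (Finset.mem_filter.1 hs').2]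
  simp only [← zsmul_eq_mul]
  exact G.sum_split_arrow q fun e => G.cornerSum t h p (e, true) + G.cornerSum t h p (e, false)

end SplitWeight

section BoundaryPotential

variable {N : ℕ} {G : PerfectCylindricalNetwork V E N N} {K : Type w} [Field K]
  (h2 : (2 : K) ≠ 0) {x y : K} (hx : x ≠ 0) (hxy : x ≠ y) {k j i l : Fin N}
  {p : Quiver.Path (G.sourcePt k) (G.sinkPt j)} {q : Quiver.Path (G.sourcePt i) (G.sinkPt l)}
  [NeZero N] {h : E × Bool → ℤ} (H : G.IsHeight (fun e => G.flow p e - G.flow q e) h)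
  (h₀ : h (G.sourceEdge 0, false) = 0)
include h2 hx hxy H h₀

theorem edgePotential_sourceEdge :
    edgePotential (y / x) h (G.sourceEdge i) = 2 * (y / x - 1) * trigRho N x y i k := by
  rw [← zpow_add_zpow_eq_trigRho h2 hx hxy, edgePotential, H.jump, flow_sourceEdge_eq_ite,
    flow_sourceEdge_eq_ite, height_sourceEdge H, h₀]
  simp only [lt_irrefl, if_true, if_false, zero_add, sub_zero]
  congr 2
  ring

theorem edgePotential_sinkEdge (hy : y ≠ 0) :
    edgePotential (y / x) h (G.sinkEdge l) =
      (y / x) ^ (G.pathIndex p - G.pathIndex q) * (2 * (y / x - 1) * trigRho N x y l j) := by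
  have ht : y / x ≠ 0 := div_ne_zero hy hx
  rw [← zpow_add_zpow_eq_trigRho h2 hx hxy, edgePotential, H.jump, flow_sinkEdge_eq_ite,
    flow_sinkEdge_eq_ite, height_sinkEdge H, G.pathIndex_sub_eq p q H, h₀, mul_add,
    ← zpow_add₀ ht, ← zpow_add₀ ht]
  simp only [lt_irrefl, if_true, if_false, sub_zero]
  congr 2
  ring

end BoundaryPotential

section SumSplitWeight

variable {N : ℕ} [NeZero N] (G : PerfectCylindricalNetwork V E N N) {K : Type w} [Field K]

theorem exists_normalized_isHeight {k j i l : Fin N}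
    (p : Quiver.Path (G.sourcePt k) (G.sinkPt j)) (q : Quiver.Path (G.sourcePt i) (G.sinkPt l)) :
    ∃ h, G.IsHeight (fun e => G.flow p e - G.flow q e) h ∧ h (G.sourceEdge 0, false) = 0 := by
  obtain ⟨h, H⟩ := G.exists_isHeight p q rfl rfl
  refine ⟨fun d => h d - h (G.sourceEdge 0, false), ⟨fun d => ?_, fun e => ?_⟩, sub_self _⟩
  · rw [H.face]
  · rw [H.jump, add_sub_right_comm]

open Classical in
theorem sum_splitWeight (h2 : (2 : K) ≠ 0) {x y : K} (hx : x ≠ 0) (hy : y ≠ 0) (hxy : x ≠ y)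
    {k j i l : Fin N} (p : Quiver.Path (G.sourcePt k) (G.sinkPt j))
    (q : Quiver.Path (G.sourcePt i) (G.sinkPt l)) :
    ∑ s : Split (G.sourcePt k) (G.sinkPt j) with s.path = p,
      ∑ s' : Split (G.sourcePt i) (G.sinkPt l) with s'.path = q, G.splitWeight (y / x) s s' =
      trigRho N x y i k - (y / x) ^ (G.pathIndex p - G.pathIndex q) * trigRho N x y l j := by
  have ht : y / x - 1 ≠ 0 := by
    rw [div_sub_one hx]
    exact div_ne_zero (sub_ne_zero.2 hxy.symm) hx
  obtain ⟨h, H, h₀⟩ := G.exists_normalized_isHeight p q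
  refine mul_left_cancel₀ (mul_ne_zero h2 ht) ?_
  rw [G.sum_splitWeight_eq_sum_cornerSum _ h₀ p q H, sum_cornerSum (div_ne_zero hy hx) h2 H,
    edgePotential_sourceEdge h2 hx hxy H h₀, edgePotential_sinkEdge h2 hx hxy H h₀ hy]
  ring

end SumSplitWeight

end PerfectCylindricalNetwork

/-! ### The bracket of boundary measurements -/

namespace PerfectCylindricalNetwork

variable {V : Type u} {E : Type v} [Fintype V] [Fintype E] {N : ℕ}
  (G : PerfectCylindricalNetwork V E N N)

section EdgeBracket

open Classical in
/-- The contribution of a common tail to the bracket of two edges. -/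
def tailBracket (K : Type w) [Field K] : ArrowBracket K G.Torus := fun a b c d e h =>
  if H : a = c then
    G.cornerCoeff K (e.1, false) (h.1, false) •
      (ofPath K (Quiver.Hom.toPath (⟨e.1, e.2.1.trans H, e.2.2⟩ : c ⟶ b)) ⊗ₜ[K]
        ofPath K (Quiver.Hom.toPath (⟨h.1, h.2.1.trans H.symm, h.2.2⟩ : a ⟶ d)))
  else 0

open Classical in
/-- The contribution of a common head to the bracket of two edges, with the opposite sign. -/
def headBracket (K : Type w) [Field K] : ArrowBracket K G.Torus := fun a b c d e h =>
  if H : b = d then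
    G.cornerCoeff K (e.1, true) (h.1, true) •
      (ofPath K (Quiver.Hom.toPath (⟨h.1, h.2.1, h.2.2.trans H.symm⟩ : c ⟶ b)) ⊗ₜ[K]
        ofPath K (Quiver.Hom.toPath (⟨e.1, e.2.1, e.2.2.trans H⟩ : a ⟶ d)))
  else 0

variable {K : Type w} [Field K]

theorem edgeBracket_eq_sub {a b c d : G.Torus} (e : a ⟶ b) (e' : c ⟶ d) :
    G.edgeBracket K e e' = G.tailBracket K e e' - G.headBracket K e e' :=
  rfl

theorem tailBracket_of_tail_eq {x y y' : G.Pt} (e : x ⟶ y) (e' : x ⟶ y') :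
    G.tailBracket K (G.gluing.map e) (G.gluing.map e') =
      G.cornerCoeff K (e.1, false) (e'.1, false) •
        (ofPath K (G.gluing.map e).toPath ⊗ₜ[K] ofPath K (G.gluing.map e').toPath) :=
  dif_pos rfl

theorem headBracket_of_head_eq {x x' y : G.Pt} (e : x ⟶ y) (e' : x' ⟶ y) :
    G.headBracket K (G.gluing.map e) (G.gluing.map e') =
      G.cornerCoeff K (e.1, true) (e'.1, true) •
        (ofPath K (G.gluing.map e').toPath ⊗ₜ[K] ofPath K (G.gluing.map e).toPath) :=
  dif_pos rfl

theorem cornerCoeff_tail_eq_zero {x y x' y' : G.Pt} (e : x ⟶ y) (e' : x' ⟶ y') (hx : x ≠ x') :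
    G.cornerCoeff K (e.1, false) (e'.1, false) = 0 :=
  cornerCoeff_eq_zero fun h => hx (e.2.1.symm.trans (Eq.trans h e'.2.1))

theorem cornerCoeff_head_eq_zero {x y x' y' : G.Pt} (e : x ⟶ y) (e' : x' ⟶ y') (hy : y ≠ y') :
    G.cornerCoeff K (e.1, true) (e'.1, true) = 0 :=
  cornerCoeff_eq_zero fun h => hy (e.2.2.symm.trans (Eq.trans h e'.2.2))

theorem tailBracket_of_tail_ne {x y x' y' : G.Pt} (e : x ⟶ y) (e' : x' ⟶ y') (hx : x ≠ x') :
    G.tailBracket K (G.gluing.map e) (G.gluing.map e') = 0 := by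
  rw [tailBracket]
  split_ifs
  · exact (congrArg (· • _) (G.cornerCoeff_tail_eq_zero e e' hx)).trans (zero_smul K _)
  · rfl

theorem headBracket_of_head_ne {x y x' y' : G.Pt} (e : x ⟶ y) (e' : x' ⟶ y') (hy : y ≠ y') :
    G.headBracket K (G.gluing.map e) (G.gluing.map e') = 0 := by
  rw [headBracket]
  split_ifs
  · exact (congrArg (· • _) (G.cornerCoeff_head_eq_zero e e' hy)).trans (zero_smul K _)
  · rfl

theorem extend_tailBracket {a b c d x y y' : G.Pt} (e : x ⟶ y) (e' : x ⟶ y')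
    (p₁ : Quiver.Path a x) (p₂ : Quiver.Path y b) (q₁ : Quiver.Path c x) (q₂ : Quiver.Path y' d) :
    Split.extend K G.gluing ⟨e, p₁, p₂⟩ ⟨e', q₁, q₂⟩
        (G.tailBracket K (G.gluing.map e) (G.gluing.map e')) =
      G.cornerCoeff K (e.1, false) (e'.1, false) •
        (ofPath K (G.gluing.mapPath ((q₁.cons e).comp p₂)) ⊗ₜ[K]
          ofPath K (G.gluing.mapPath ((p₁.cons e').comp q₂))) := by
  rw [tailBracket_of_tail_eq, map_smul, Split.extend, TensorProduct.map_tmul]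
  simp [Prefunctor.mapPath_comp]

theorem extend_headBracket {a b c d x x' y : G.Pt} (e : x ⟶ y) (e' : x' ⟶ y)
    (p₁ : Quiver.Path a x) (p₂ : Quiver.Path y b) (q₁ : Quiver.Path c x') (q₂ : Quiver.Path y d) :
    Split.extend K G.gluing ⟨e, p₁, p₂⟩ ⟨e', q₁, q₂⟩
        (G.headBracket K (G.gluing.map e) (G.gluing.map e')) =
      G.cornerCoeff K (e.1, true) (e'.1, true) •
        (ofPath K (G.gluing.mapPath ((q₁.cons e').comp p₂)) ⊗ₜ[K]
          ofPath K (G.gluing.mapPath ((p₁.cons e).comp q₂))) := by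
  rw [headBracket_of_head_eq, map_smul, Split.extend, TensorProduct.map_tmul]
  simp [Prefunctor.mapPath_comp]

end EdgeBracket

section BoundaryMeasurement

variable {K : Type w} [Field K]

theorem sum_tailBracket {x y : K} (hx : x ≠ 0) (hy : y ≠ 0) (i j k l : Fin N) :
    ∑ s : Split (G.sourcePt i) (G.sinkPt j), ∑ s' : Split (G.sourcePt k) (G.sinkPt l),
      (x ^ G.pathIndex s.path * y ^ G.pathIndex s'.path) • s.extend K G.gluing s'
        (G.tailBracket K (G.gluing.map s.arrow) (G.gluing.map s'.arrow)) =
    ∑ s : Split (G.sourcePt k) (G.sinkPt j), ∑ s' : Split (G.sourcePt i) (G.sinkPt l),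
      (x ^ G.pathIndex s.path * y ^ G.pathIndex s'.path *
        (G.cornerCoeff K (s.arrow.1, false) (s'.arrow.1, false) *
          (y / x) ^ (G.pathIndex s.before - G.pathIndex s'.before))) •
        (ofPath K (G.gluing.mapPath s.path) ⊗ₜ[K] ofPath K (G.gluing.mapPath s'.path)) := by
  refine Split.sum_swap_tail _ _ (fun s s' h => ?_) (fun s s' h => ?_) ?_
  · rw [G.tailBracket_of_tail_ne _ _ h, map_zero, smul_zero]
  · rw [G.cornerCoeff_tail_eq_zero _ _ h, zero_mul, mul_zero, zero_smul]
  · intro v w w' e e' p₁ p₂ q₁ q₂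
    rw [extend_tailBracket, smul_smul]
    congr 1
    simp only [Split.path, pathIndex_comp, pathIndex_cons, zpow_add₀ hx, zpow_add₀ hy, div_zpow,
      zpow_sub₀ hx, zpow_sub₀ hy]
    field_simp

theorem sum_headBracket {x y : K} (hx : x ≠ 0) (hy : y ≠ 0) (i j k l : Fin N) :
    ∑ s : Split (G.sourcePt i) (G.sinkPt j), ∑ s' : Split (G.sourcePt k) (G.sinkPt l),
      (x ^ G.pathIndex s.path * y ^ G.pathIndex s'.path) • s.extend K G.gluing s'
        (G.headBracket K (G.gluing.map s.arrow) (G.gluing.map s'.arrow)) =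
    -∑ s : Split (G.sourcePt k) (G.sinkPt j), ∑ s' : Split (G.sourcePt i) (G.sinkPt l),
      (x ^ G.pathIndex s.path * y ^ G.pathIndex s'.path *
        (G.cornerCoeff K (s.arrow.1, true) (s'.arrow.1, true) *
          (y / x) ^ (G.pathIndex (s.before.cons s.arrow) -
            G.pathIndex (s'.before.cons s'.arrow)))) •
        (ofPath K (G.gluing.mapPath s.path) ⊗ₜ[K] ofPath K (G.gluing.mapPath s'.path)) := by
  simp only [← Finset.sum_neg_distrib]
  refine Split.sum_swap_head _ _ (fun s s' h => ?_) (fun s s' h => ?_) ?_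
  · rw [G.headBracket_of_head_ne _ _ h, map_zero, smul_zero]
  · rw [G.cornerCoeff_head_eq_zero _ _ h, zero_mul, mul_zero, zero_smul, neg_zero]
  · intro v v' w e e' p₁ p₂ q₁ q₂
    rw [extend_headBracket, smul_smul, ← neg_smul]
    congr 1
    rw [G.cornerCoeff_swap]
    simp only [Split.path, pathIndex_comp, pathIndex_cons, zpow_add₀ hx, zpow_add₀ hy, div_zpow,
      zpow_sub₀ hx, zpow_sub₀ hy]
    field_simp

theorem sum_edgeBracket {x y : K} (hx : x ≠ 0) (hy : y ≠ 0) (i j k l : Fin N) :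
    ∑ s : Split (G.sourcePt i) (G.sinkPt j), ∑ s' : Split (G.sourcePt k) (G.sinkPt l),
      (x ^ G.pathIndex s.path * y ^ G.pathIndex s'.path) • s.extend K G.gluing s'
        (G.edgeBracket K (G.gluing.map s.arrow) (G.gluing.map s'.arrow)) =
    ∑ s : Split (G.sourcePt k) (G.sinkPt j), ∑ s' : Split (G.sourcePt i) (G.sinkPt l),
      (x ^ G.pathIndex s.path * y ^ G.pathIndex s'.path * G.splitWeight (y / x) s s') •
        (ofPath K (G.gluePath s.path) ⊗ₜ[K] ofPath K (G.gluePath s'.path)) := by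
  simp only [edgeBracket_eq_sub, map_sub, smul_sub, Finset.sum_sub_distrib]
  rw [G.sum_tailBracket hx hy, G.sum_headBracket hx hy, sub_neg_eq_add]
  simp only [← Finset.sum_add_distrib, ← add_smul, ← mul_add]
  rfl

theorem boundaryMeasurement_eq_sum (z : K) (i j : Fin N) :
    G.boundaryMeasurement K z i j =
      ∑ p : Quiver.Path (G.sourcePt i) (G.sinkPt j),
        z ^ G.pathIndex p • ofPath K (G.gluePath p) := by
  simp [boundaryMeasurement, cylinderMeasurement]

theorem boundaryMeasurement_tmul (x y : K) (i j k l : Fin N) :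
    G.boundaryMeasurement K x i j ⊗ₜ[K] G.boundaryMeasurement K y k l =
      ∑ p : Quiver.Path (G.sourcePt i) (G.sinkPt j), ∑ q : Quiver.Path (G.sourcePt k) (G.sinkPt l),
        (x ^ G.pathIndex p * y ^ G.pathIndex q) •
          (ofPath K (G.gluePath p) ⊗ₜ[K] ofPath K (G.gluePath q)) := by
  simp only [boundaryMeasurement_eq_sum, TensorProduct.sum_tmul, TensorProduct.tmul_sum,
    TensorProduct.smul_tmul_smul]
  exact Finset.sum_comm

open Classical in
theorem br_ofPath_gluePath {i j k l : Fin N} (p : Quiver.Path (G.sourcePt i) (G.sinkPt j))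
    (q : Quiver.Path (G.sourcePt k) (G.sinkPt l)) :
    (G.doubleBracket K).br (G.marked i) (G.marked j) (G.marked k) (G.marked l)
        (ofPath K (G.gluePath p)) (ofPath K (G.gluePath q)) =
      ∑ s : Split (G.sourcePt i) (G.sinkPt j) with s.path = p,
        ∑ s' : Split (G.sourcePt k) (G.sinkPt l) with s'.path = q,
          s.extend K G.gluing s'
            (G.edgeBracket K (G.gluing.map s.arrow) (G.gluing.map s'.arrow)) := by
  rw [← pathBr_mapPath]
  change linBr (G.edgeBracket K) _ _ _ _ _ _ = _
  rw [linBr, Mor.lift_ofPath, Mor.lift_ofPath]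
  rfl

theorem br_boundaryMeasurement_eq_sum_edgeBracket (x y : K) (i j k l : Fin N) :
    (G.doubleBracket K).br (G.marked i) (G.marked j) (G.marked k) (G.marked l)
        (G.boundaryMeasurement K x i j) (G.boundaryMeasurement K y k l) =
      ∑ s : Split (G.sourcePt i) (G.sinkPt j), ∑ s' : Split (G.sourcePt k) (G.sinkPt l),
        (x ^ G.pathIndex s.path * y ^ G.pathIndex s'.path) • s.extend K G.gluing s'
          (G.edgeBracket K (G.gluing.map s.arrow) (G.gluing.map s'.arrow)) := by
  classical
  rw [← Split.sum_path_path fun p q s s' => (x ^ G.pathIndex p * y ^ G.pathIndex q) •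
    s.extend K G.gluing s' (G.edgeBracket K (G.gluing.map s.arrow) (G.gluing.map s'.arrow))]
  simp only [boundaryMeasurement_eq_sum, map_sum, LinearMap.sum_apply, map_smul,
    LinearMap.smul_apply, Finset.smul_sum]
  rw [Finset.sum_comm]
  refine Finset.sum_congr rfl fun p _ => Finset.sum_congr rfl fun q _ => ?_
  rw [smul_smul, mul_comm]
  simp only [← Finset.smul_sum]
  exact congrArg (_ • ·) (G.br_ofPath_gluePath p q)

theorem br_boundaryMeasurement [NeZero N] (h2 : (2 : K) ≠ 0) {x y : K} (hx : x ≠ 0) (hy : y ≠ 0)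
    (hxy : x ≠ y) (i j k l : Fin N) :
    (G.doubleBracket K).br (G.marked i) (G.marked j) (G.marked k) (G.marked l)
        (G.boundaryMeasurement K x i j) (G.boundaryMeasurement K y k l) =
      trigRho N x y i k •
          (G.boundaryMeasurement K x k j ⊗ₜ[K] G.boundaryMeasurement K y i l) -
        trigRho N x y l j •
          (G.boundaryMeasurement K y k j ⊗ₜ[K] G.boundaryMeasurement K x i l) := by
  classical
  rw [br_boundaryMeasurement_eq_sum_edgeBracket, G.sum_edgeBracket hx hy,
    ← Split.sum_path_path fun p q s s' => (x ^ G.pathIndex p * y ^ G.pathIndex q *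
      G.splitWeight (y / x) s s') • (ofPath K (G.gluePath p) ⊗ₜ[K] ofPath K (G.gluePath q))]
  simp only [← Finset.sum_smul, ← Finset.mul_sum, G.sum_splitWeight h2 hx hy hxy,
    boundaryMeasurement_tmul, Finset.smul_sum, ← Finset.sum_sub_distrib, smul_smul, ← sub_smul]
  refine Finset.sum_congr rfl fun p _ => Finset.sum_congr rfl fun q _ => ?_
  congr 1
  rw [div_zpow, zpow_sub₀ hx, zpow_sub₀ hy]
  field_simp

end BoundaryMeasurement

end PerfectCylindricalNetwork

theorem specLam_ne_zero : specLam ≠ 0 := by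
  rw [specLam, Ne, FaithfulSMul.algebraMap_eq_zero_iff]
  exact MvPolynomial.X_ne_zero 0

theorem specMu_ne_zero : specMu ≠ 0 := by
  rw [specMu, Ne, FaithfulSMul.algebraMap_eq_zero_iff]
  exact MvPolynomial.X_ne_zero 1

theorem specLam_ne_specMu : specLam ≠ specMu := fun h => by
  have index_eq := MvPolynomial.X_injective (IsFractionRing.injective (MvPolynomial (Fin 2) ℂ) _ h)
  exact absurd index_eq (by decide)

instance : CharZero SpectralField :=
  charZero_of_injective_algebraMap (IsFractionRing.injective (MvPolynomial (Fin 2) ℂ) SpectralField)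

end NCNetwork

end

theorem mainTheorem3_general {V E : Type*} [Fintype V] [Fintype E] {N : ℕ} {K : Type*} [Field K]
    (h2 : (2 : K) ≠ 0) {x y : K} (hx : x ≠ 0) (hy : y ≠ 0) (hxy : x ≠ y)
    (G : NCNetwork.PerfectCylindricalNetwork V E N N) (k : ℕ) (b₁ b₂ : Fin N) :
    G.hBracket K b₁ b₂
        (NCNetwork.PMat.cyclicTrace (NCNetwork.PMat.pow (G.boundaryMeasurement K x) k))
        (G.boundaryMeasurement K y b₁ b₂) =
      NCNetwork.PMat.mul (G.laxM x y k) (G.boundaryMeasurement K y) b₁ b₂ -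
        NCNetwork.PMat.mul (G.boundaryMeasurement K y) (G.laxM x y k) b₁ b₂ := by
  have : NeZero N := ⟨b₁.pos.ne'⟩
  exact (G.doubleBracket K).hBracket_cyclicTrace_pow _ _ _
    (G.br_boundaryMeasurement h2 hx hy hxy) k b₁ b₂

theorem mainTheorem3 {V E : Type*} [Fintype V] [Fintype E] {N : ℕ}
    (G : NCNetwork.PerfectCylindricalNetwork V E N N) (k : ℕ) (b₁ b₂ : Fin N) :
    G.hBracket NCNetwork.SpectralField b₁ b₂
        (NCNetwork.PMat.cyclicTrace
          (NCNetwork.PMat.pow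
            (G.boundaryMeasurement NCNetwork.SpectralField NCNetwork.specLam) k))
        (G.boundaryMeasurement NCNetwork.SpectralField NCNetwork.specMu b₁ b₂) =
      NCNetwork.PMat.mul (G.laxM NCNetwork.specLam NCNetwork.specMu k)
          (G.boundaryMeasurement NCNetwork.SpectralField NCNetwork.specMu) b₁ b₂ -
        NCNetwork.PMat.mul (G.boundaryMeasurement NCNetwork.SpectralField NCNetwork.specMu)
          (G.laxM NCNetwork.specLam NCNetwork.specMu k) b₁ b₂ :=
  mainTheorem3_general two_ne_zero NCNetwork.specLam_ne_zero NCNetwork.specMu_ne_zero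
    NCNetwork.specLam_ne_specMu G k b₁ b₂
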